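/- Manifolds are smooth, finite-dimensional, Hausdorff, second countable and without boundary; vector bundles are smooth, complex and of finite (locally constant) rank. Let $M$ be a compact manifold and let $\mathcal G=(Y,L,\mu)$ be a bundle gerbe on $M$: a surjective submersion $\pi:Y\to M$, a hermitian line bundle $L$ on $Y^{[2]}=Y\times_M Y$, and a bundle isomorphism $\mu_{y_1y_2y_3}:L_{(y_1,y_2)}\otimes L_{(y_2,y_3)}\to L_{(y_1,y_3)}$ over $Y^{[3]}$ that is associative over $Y^{[4]}$. A $\mathcal G$-module is a pair $\mathcal N=(E',\rho')$ of a hermitian vector bundle $E'\to Y$ and an isomorphism of hermitian vector bundles $\rho'_{y_1y_2}:L_{(y_1,y_2)}\otimes E'_{y_2}\to E'_{y_1}$ over $Y^{[2]}$ that is compatible with $\mu$, i.e. $\rho'_{y_1y_2}(a\otimes\rho'_{y_2y_3}(b\otimes v))=\rho'_{y_1y_3}(\mu(a\otimes b)\otimes v)$ over $Y^{[3]}$. A morphism $(E',\rho')\to(E'',\rho'')$ is a morphism of complex vector bundles $f:E'\to E''$ (not necessarily isometric) with $f_{y_1}\circ\rho'_{y_1y_2}=\rho''_{y_1y_2}\circ(\mathrm{id}\otimes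 f_{y_2})$. These form a $\mathbb C$-linear category $\mathcal G\text{-mod}$. Let $\mathcal M=(E,\rho)$ be a nontrivial $\mathcal G$-module, that is, one that is nonzero over each connected component of $M$. For a $\mathcal G$-module $\mathcal N=(E',\rho')$, the isomorphisms $$\mathrm{Hom}(E_{y_2},E'_{y_2})\to\mathrm{Hom}(E_{y_1},E'_{y_1}),\qquad \beta\mapsto\rho'_{y_1y_2}\circ(\mathrm{id}_L\otimes\beta)\circ\rho_{y_1y_2}^{-1},$$ make $\mathrm{Hom}(E,E')$ into a vector bundle on $Y$ with descent datum for $\pi$. Let $D(\mathrm{Hom}(E,E'))$ be the vector bundle on $M$ that it defines (its fibre at $m$ consists of the families $(\beta_y)_{y\in\pi^{-1}(m)}$ compatible with these isomorphisms), and put $$\mathcal A^{\mathcal M\mathcal N}=\Gamma(M,D(\mathrm{Hom}(E,E'))),\qquad \mathcal A^{\mathcal M}=\mathcal A^{\mathcal M\mathcal M}.$$ Composition of homomorphisms makes $\mathcal A^{\mathcal M}$ an algebra and $\mathcal A^{\mathcal M\mathcal N}$ a right $\mathcal A^{\mathcal M}$-module, and $f:\mathcal N\to\mathcal P$ induces an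 $\mathcal A^{\mathcal M}$-linear map $\mathcal A^{\mathcal M\mathcal N}\to\mathcal A^{\mathcal M\mathcal P}$ by $\beta\mapsto f\circ\beta$. Then $\mathcal A^{\mathcal M}$ is an Azumaya algebra over $M$ (it is the algebra of sections of the algebra bundle $D(\mathrm{End}(E))$ on $M$, whose fibres are Azumaya algebras over $\mathbb C$); each $\mathcal A^{\mathcal M\mathcal N}$ is a finitely generated projective right $\mathcal A^{\mathcal M}$-module; and the functor $$\mathcal F^{\mathcal M}:\mathcal G\text{-mod}\to\mathrm{pfmod}\text{-}\mathcal A^{\mathcal M},\qquad \mathcal N\mapsto\mathcal A^{\mathcal M\mathcal N},$$ to the category of finitely generated projective right $\mathcal A^{\mathcal M}$-modules is $\mathbb C$-linear, fully faithful and essentially surjective. In particular it is an equivalence of categories. -/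

import Mathlib

open Set Filter Topology TensorProduct CategoryTheory
open scoped Manifold ContDiff

universe u

noncomputable section

namespace GerbeMod

/-! ### Spaces with smooth complex functions -/

/-- A sheaf of smooth complex valued functions on a topological space `X`, given by its germs:
`S.SmoothAt f x` says that `f` is smooth on some neighbourhood of `x`.  Only two instances are used:
the one of a smooth manifold (`ofManifold`) and the one of a subspace of a smooth manifold
(`induced`). -/
structure SmoothFunctions (X : Type u) [TopologicalSpace X] where
  SmoothAt : (X → ℂ) → X → Prop
  eventually : ∀ {f x}, SmoothAt f x → ∀ᶠ x' in 𝓝 x, SmoothAt f x'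
  congr : ∀ {f g x}, SmoothAt f x → f =ᶠ[𝓝 x] g → SmoothAt g x
  const : ∀ (c : ℂ) (x), SmoothAt (fun _ => c) x
  add : ∀ {f g x}, SmoothAt f x → SmoothAt g x → SmoothAt (fun x' => f x' + g x') x
  mul : ∀ {f g x}, SmoothAt f x → SmoothAt g x → SmoothAt (fun x' => f x' * g x') x

namespace SmoothFunctions

/-- The `C^∞` functions of a smooth manifold. -/
def ofManifold {E H : Type*} [NormedAddCommGroup E] [NormedSpace ℝ E] [TopologicalSpace H]
    (I : ModelWithCorners ℝ E H) (X : Type u) [TopologicalSpace X] [ChartedSpace H X] :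
    SmoothFunctions X where
  SmoothAt f x := ∀ᶠ x' in 𝓝 x, ContMDiffAt I 𝓘(ℝ, ℂ) ∞ f x'
  eventually h := h.eventually_nhds
  congr h hfg := by
    filter_upwards [h, hfg.eventually_nhds] with x hx hx'
    exact hx.congr_of_eventuallyEq (EventuallyEq.symm hx')
  const c x := Eventually.of_forall fun x' => contMDiffAt_const
  add h h' := by
    filter_upwards [h, h'] with x hx hx'
    exact ContMDiffAt.add hx hx'
  mul h h' := by
    filter_upwards [h, h'] with x hx hx'
    exact (contDiff_mul (𝕜 := ℝ) (𝔸 := ℂ)).contMDiff.contMDiffAt.comp x (hx.prodMk_space hx')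

/-- Smooth functions on a space `Z` mapped continuously to `X`: those that are locally of the form
`g ∘ ι` with `g` smooth on `X`.  For an embedded submanifold `Z` of a manifold `X` these are
exactly the smooth functions of the manifold `Z`. -/
def induced {X Z : Type u} [TopologicalSpace X] [TopologicalSpace Z] (S : SmoothFunctions X)
    (ι : Z → X) (hι : Continuous ι) : SmoothFunctions Z where
  SmoothAt f z := ∃ g : X → ℂ, S.SmoothAt g (ι z) ∧ f =ᶠ[𝓝 z] g ∘ ι
  eventually := by
    rintro f z ⟨g, hg, hfg⟩
    filter_upwards [hι.continuousAt.eventually (S.eventually hg), hfg.eventually_nhds] with z' h h'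
    exact ⟨g, h, h'⟩
  congr := by
    rintro f f' z ⟨g, hg, hfg⟩ h
    exact ⟨g, hg, h.symm.trans hfg⟩
  const c z := ⟨fun _ => c, S.const c _, EventuallyEq.rfl⟩
  add := by
    rintro f f' z ⟨g, hg, hfg⟩ ⟨g', hg', hfg'⟩
    exact ⟨_, S.add hg hg', by filter_upwards [hfg, hfg'] with z h h'; simp [h, h']⟩
  mul := by
    rintro f f' z ⟨g, hg, hfg⟩ ⟨g', hg', hfg'⟩
    exact ⟨_, S.mul hg hg', by filter_upwards [hfg, hfg'] with z h h'; simp [h, h']⟩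

variable {X : Type u} [TopologicalSpace X] (S : SmoothFunctions X)

lemma sum {κ : Type*} (s : Finset κ) {f : κ → X → ℂ} {x : X} (h : ∀ k ∈ s, S.SmoothAt (f k) x) :
    S.SmoothAt (fun x' => ∑ k ∈ s, f k x') x := by
  classical
  induction s using Finset.induction_on with
  | empty => simpa using S.const 0 x
  | insert a s ha ih =>
    simp only [Finset.sum_insert ha]
    exact S.add (h a (by simp)) (ih fun k hk => h k (by simp [hk]))

/-- Smooth maps: continuous maps that pull smooth functions back to smooth functions. -/
structure IsSmoothMap {X Z : Type u} [TopologicalSpace X] [TopologicalSpace Z]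
    (S : SmoothFunctions X) (T : SmoothFunctions Z) (f : X → Z) : Prop where
  continuous : Continuous f
  comp : ∀ (g : Z → ℂ) (x : X), T.SmoothAt g (f x) → S.SmoothAt (g ∘ f) x

end SmoothFunctions

/-! ### Smooth complex vector bundles -/

section Triv

variable {X : Type u} [TopologicalSpace X]

/-- `τ` is a smooth trivialization, over the open set `U`, of the family of vector spaces `Fiber`
with smooth sections `SmoothAt`: it is a linear isomorphism onto `ℂ ^ ι` on the fibres over `U`,
and a section is smooth near a point of `U` exactly if its components are. -/
structure IsTrivialization (S : SmoothFunctions X) {Fiber : X → Type u}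
    [∀ x, AddCommGroup (Fiber x)] [∀ x, Module ℂ (Fiber x)]
    (SmoothAt : (∀ x, Fiber x) → X → Prop) (U : Set X) {ι : Type}
    (τ : ∀ x, Fiber x →ₗ[ℂ] (ι → ℂ)) : Prop where
  isOpen : IsOpen U
  bijective : ∀ x ∈ U, Function.Bijective (τ x)
  smoothAt_iff : ∀ (s : ∀ x, Fiber x), ∀ x ∈ U,
    SmoothAt s x ↔ ∀ i, S.SmoothAt (fun x' => τ x' (s x') i) x

/-- A smooth complex vector bundle of finite (locally constant) rank: a family of complex vector
spaces together with its sheaf of smooth sections (`SmoothAt s x` says that the section `s` is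
smooth on a neighbourhood of `x`), that is trivial near each point. -/
structure SmoothBundle (S : SmoothFunctions X) : Type (u + 1) where
  Fiber : X → Type u
  [addCommGroup : ∀ x, AddCommGroup (Fiber x)]
  [module : ∀ x, Module ℂ (Fiber x)]
  SmoothAt : (∀ x, Fiber x) → X → Prop
  locallyTrivial : ∀ x₀ : X, ∃ (U : Set X) (ι : Type) (_ : Finite ι)
    (τ : ∀ x, Fiber x →ₗ[ℂ] (ι → ℂ)), x₀ ∈ U ∧ IsTrivialization S SmoothAt U τ

end Triv

namespace SmoothBundle

attribute [instance] SmoothBundle.addCommGroup SmoothBundle.module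

section Basic

variable {X : Type u} [TopologicalSpace X] {S : SmoothFunctions X} (E : SmoothBundle S)

lemma smoothAt_congr {s t : ∀ x, E.Fiber x} {x : X} (h : E.SmoothAt s x)
    (hst : ∀ᶠ x' in 𝓝 x, s x' = t x') : E.SmoothAt t x := by
  obtain ⟨U, ι, _, τ, hx, hτ⟩ := E.locallyTrivial x
  rw [hτ.smoothAt_iff _ _ hx] at h ⊢
  intro i
  refine S.congr (h i) ?_
  filter_upwards [hst] with x' hx'
  rw [hx']

lemma smoothAt_eventually {s : ∀ x, E.Fiber x} {x : X} (h : E.SmoothAt s x) :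
    ∀ᶠ x' in 𝓝 x, E.SmoothAt s x' := by
  obtain ⟨U, ι, _, τ, hx, hτ⟩ := E.locallyTrivial x
  rw [hτ.smoothAt_iff _ _ hx] at h
  filter_upwards [eventually_all.2 fun i => S.eventually (h i), hτ.isOpen.mem_nhds hx] with x' h' hU
  exact (hτ.smoothAt_iff _ _ hU).2 h'

lemma smoothAt_zero (x : X) : E.SmoothAt (fun _ => 0) x := by
  obtain ⟨U, ι, _, τ, hx, hτ⟩ := E.locallyTrivial x
  rw [hτ.smoothAt_iff _ _ hx]
  intro i
  simpa using S.const 0 x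

lemma smoothAt_add {s t : ∀ x, E.Fiber x} {x : X} (h : E.SmoothAt s x) (h' : E.SmoothAt t x) :
    E.SmoothAt (fun x' => s x' + t x') x := by
  obtain ⟨U, ι, _, τ, hx, hτ⟩ := E.locallyTrivial x
  rw [hτ.smoothAt_iff _ _ hx] at h h' ⊢
  intro i
  simpa using S.add (h i) (h' i)

lemma smoothAt_smul {c : X → ℂ} {s : ∀ x, E.Fiber x} {x : X} (h : S.SmoothAt c x)
    (h' : E.SmoothAt s x) : E.SmoothAt (fun x' => c x' • s x') x := by
  obtain ⟨U, ι, _, τ, hx, hτ⟩ := E.locallyTrivial x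
  rw [hτ.smoothAt_iff _ _ hx] at h' ⊢
  intro i
  simpa using S.mul h (h' i)

lemma smoothAt_sum {κ : Type*} (F : Finset κ) {s : κ → ∀ x, E.Fiber x} {x : X}
    (h : ∀ k ∈ F, E.SmoothAt (s k) x) : E.SmoothAt (fun x' => ∑ k ∈ F, s k x') x := by
  classical
  induction F using Finset.induction_on with
  | empty => simpa using E.smoothAt_zero x
  | insert a F ha ih =>
    simp only [Finset.sum_insert ha]
    exact E.smoothAt_add (h a (by simp)) (ih fun k hk => h k (by simp [hk]))

/-- The global sections, as a complex vector space. -/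
def sections : Submodule ℂ (∀ x, E.Fiber x) where
  carrier := {s | ∀ x, E.SmoothAt s x}
  add_mem' h h' x := E.smoothAt_add (h x) (h' x)
  zero_mem' := E.smoothAt_zero
  smul_mem' c _ h x := E.smoothAt_smul (S.const c x) (h x)

variable {E} in
/-- The local frame given by a local trivialization. -/
lemma _root_.GerbeMod.IsTrivialization.exists_frame {U : Set X} {ι : Type} [Fintype ι]
    {τ : ∀ x, E.Fiber x →ₗ[ℂ] (ι → ℂ)} (hτ : IsTrivialization S E.SmoothAt U τ) :
    ∃ e : ι → ∀ x, E.Fiber x, (∀ i, ∀ x ∈ U, E.SmoothAt (e i) x) ∧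
      (∀ x ∈ U, ∀ v : E.Fiber x, v = ∑ i, τ x v i • e i x) ∧
      (∀ x ∈ U, ∀ c : ι → ℂ, τ x (∑ i, c i • e i x) = c) := by
  classical
  let e : ι → ∀ x, E.Fiber x := fun i x =>
    if h : x ∈ U then ((hτ.bijective x h).2 (Pi.single i 1)).choose else 0
  have he : ∀ i, ∀ x ∈ U, τ x (e i x) = Pi.single i 1 := fun i x hx => by
    simp only [e, dif_pos hx]
    exact ((hτ.bijective x hx).2 (Pi.single i 1)).choose_spec
  have hc : ∀ x ∈ U, ∀ c : ι → ℂ, τ x (∑ i, c i • e i x) = c := fun x hx c => by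
    simp only [map_sum, map_smul, he _ x hx]
    exact (pi_eq_sum_univ' c).symm
  refine ⟨e, fun i x hx => ?_, fun x hx v => (hτ.bijective x hx).1 (hc x hx _).symm, hc⟩
  rw [hτ.smoothAt_iff _ _ hx]
  intro j
  refine S.congr (S.const (Pi.single (M := fun _ => ℂ) i 1 j) x) ?_
  filter_upwards [hτ.isOpen.mem_nhds hx] with x' hx'
  rw [he i x' hx']

lemma finiteDimensional (x : X) : FiniteDimensional ℂ (E.Fiber x) := by
  obtain ⟨U, ι, _, τ, hx, hτ⟩ := E.locallyTrivial x
  exact (LinearEquiv.ofBijective _ (hτ.bijective x hx)).symm.finiteDimensional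

end Basic

/-! ### Morphisms, and homomorphism, tensor product and pullback bundles -/

section Constructions

variable {X : Type u} [TopologicalSpace X] {S : SmoothFunctions X}

/-- Morphisms of smooth vector bundles over a fixed base: smooth families of linear maps. -/
@[ext]
structure Hom (E E' : SmoothBundle S) : Type u where
  map : ∀ x, E.Fiber x →ₗ[ℂ] E'.Fiber x
  smooth : ∀ s x, E.SmoothAt s x → E'.SmoothAt (fun x' => map x' (s x')) x

/-- Isomorphisms of smooth vector bundles over a fixed base. -/
structure Iso (E E' : SmoothBundle S) : Type u where
  map : ∀ x, E.Fiber x ≃ₗ[ℂ] E'.Fiber x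
  smooth : ∀ s x, E.SmoothAt s x → E'.SmoothAt (fun x' => map x' (s x')) x
  smooth_symm : ∀ s x, E'.SmoothAt s x → E.SmoothAt (fun x' => (map x').symm (s x')) x

/-- The homomorphism bundle `Hom(E, E')`; a section is smooth if it maps smooth sections to smooth
sections. -/
@[reducible]
def homBundle (E E' : SmoothBundle S) : SmoothBundle S where
  Fiber x := E.Fiber x →ₗ[ℂ] E'.Fiber x
  SmoothAt β x := ∀ s, E.SmoothAt s x → E'.SmoothAt (fun x' => β x' (s x')) x
  locallyTrivial x₀ := by
    classical
    obtain ⟨U, ι, hι, τ, hx, hτ⟩ := E.locallyTrivial x₀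
    obtain ⟨U', ι', hι', τ', hx', hτ'⟩ := E'.locallyTrivial x₀
    have := Fintype.ofFinite ι
    have := Fintype.ofFinite ι'
    obtain ⟨e, he, hev, hec⟩ := hτ.exists_frame
    obtain ⟨e', he', hev', hec'⟩ := hτ'.exists_frame
    refine ⟨U ∩ U', ι × ι', inferInstance,
      fun x => LinearMap.pi fun p => LinearMap.proj p.2 ∘ₗ τ' x ∘ₗ LinearMap.applyₗ (e p.1 x),
      ⟨hx, hx'⟩, hτ.isOpen.inter hτ'.isOpen, ?_, ?_⟩
    · rintro x ⟨hxU, hxU'⟩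
      constructor
      · rw [← LinearMap.ker_eq_bot, LinearMap.ker_eq_bot']
        intro β hβ
        ext v
        rw [hev x hxU v, map_sum]
        refine Finset.sum_eq_zero fun i _ => ?_
        rw [map_smul]
        have : β (e i x) = 0 := (hτ'.bijective x hxU').1 (by
          ext j
          simpa using congrFun hβ (i, j))
        rw [this, smul_zero]
      · intro c
        refine ⟨∑ i, (LinearMap.proj i ∘ₗ τ x).smulRight (∑ j, c (i, j) • e' j x), ?_⟩
        have hei : ∀ i, τ x (e i x) = Pi.single i 1 := fun i => by
          have := hec x hxU (Pi.single i 1)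
          simpa [Pi.single_apply, ite_smul] using this
        ext ⟨i, j⟩
        simp only [LinearMap.pi_apply, LinearMap.comp_apply, LinearMap.applyₗ_apply_apply,
          LinearMap.sum_apply, LinearMap.smulRight_apply, LinearMap.proj_apply, hei]
        have := congrFun (hec' x hxU' fun j => c (i, j)) j
        simpa [Pi.single_apply, ite_smul] using this
    · rintro β x ⟨hxU, hxU'⟩
      constructor
      · rintro h ⟨i, j⟩
        exact (hτ'.smoothAt_iff _ _ hxU').1 (h _ (he i x hxU)) j
      · intro h s hs
        have h1 : ∀ i, E'.SmoothAt (fun x' => β x' (e i x')) x := fun i =>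
          (hτ'.smoothAt_iff _ _ hxU').2 fun j => h (i, j)
        refine E'.smoothAt_congr (E'.smoothAt_sum Finset.univ fun i _ =>
          E'.smoothAt_smul ((hτ.smoothAt_iff _ _ hxU).1 hs i) (h1 i)) ?_
        filter_upwards [hτ.isOpen.mem_nhds hxU] with x' hx'
        conv_rhs => rw [hev x' hx' (s x'), map_sum]
        simp

/-- The tensor product bundle `E ⊗ E'`; a section is smooth if locally it is a finite sum of tensor
products of smooth sections. -/
@[reducible]
def tensor (E E' : SmoothBundle S) : SmoothBundle S where
  Fiber x := E.Fiber x ⊗[ℂ] E'.Fiber x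
  SmoothAt t x := ∃ (κ : Type) (_ : Fintype κ) (a : κ → ∀ x, E.Fiber x) (b : κ → ∀ x, E'.Fiber x),
    (∀ k, E.SmoothAt (a k) x) ∧ (∀ k, E'.SmoothAt (b k) x) ∧
      ∀ᶠ x' in 𝓝 x, t x' = ∑ k, a k x' ⊗ₜ[ℂ] b k x'
  locallyTrivial x₀ := by
    classical
    obtain ⟨U, ι, hι, τ, hx, hτ⟩ := E.locallyTrivial x₀
    obtain ⟨U', ι', hι', τ', hx', hτ'⟩ := E'.locallyTrivial x₀
    have := Fintype.ofFinite ι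
    have := Fintype.ofFinite ι'
    obtain ⟨e, he, hev, hec⟩ := hτ.exists_frame
    obtain ⟨e', he', hev', hec'⟩ := hτ'.exists_frame
    let B := ((Pi.basisFun ℂ ι).tensorProduct (Pi.basisFun ℂ ι')).equivFun
    have hB : ∀ (v : ι → ℂ) (w : ι' → ℂ) (p : ι × ι'), B (v ⊗ₜ w) p = v p.1 * w p.2 := by
      rintro v w ⟨i, j⟩
      rw [Module.Basis.equivFun_apply]
      erw [Module.Basis.tensorProduct_repr_tmul_apply]
      simp [mul_comm]
    have hTbij : ∀ x ∈ U ∩ U', Function.Bijective (B.toLinearMap ∘ₗ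
        TensorProduct.map (τ x) (τ' x)) := by
      rintro x ⟨hxU, hxU'⟩
      rw [LinearMap.coe_comp]
      exact B.bijective.comp (TensorProduct.congr (LinearEquiv.ofBijective _ (hτ.bijective x hxU))
        (LinearEquiv.ofBijective _ (hτ'.bijective x hxU'))).bijective
    refine ⟨U ∩ U', ι × ι', inferInstance,
      fun x => B.toLinearMap ∘ₗ TensorProduct.map (τ x) (τ' x),
      ⟨hx, hx'⟩, hτ.isOpen.inter hτ'.isOpen, hTbij, ?_⟩
    · rintro t x ⟨hxU, hxU'⟩
      constructor
      · rintro ⟨κ, _, a, b, ha, hb, ht⟩ ⟨i, j⟩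
        refine S.congr (S.sum Finset.univ fun k _ => S.mul ((hτ.smoothAt_iff _ _ hxU).1 (ha k) i)
          ((hτ'.smoothAt_iff _ _ hxU').1 (hb k) j)) ?_
        filter_upwards [ht] with x' hx'
        simp [hx', hB]
      · intro h
        refine ⟨ι × ι', inferInstance, fun p x' => (B.toLinearMap ∘ₗ
          TensorProduct.map (τ x') (τ' x')) (t x') p • e p.1 x', fun p => e' p.2,
          fun p => E.smoothAt_smul (h p) (he p.1 x hxU), fun p => he' p.2 x hxU', ?_⟩
        filter_upwards [(hτ.isOpen.inter hτ'.isOpen).mem_nhds ⟨hxU, hxU'⟩] with x' hx'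
        apply (hTbij x' hx').1
        have hei : ∀ i, τ x' (e i x') = Pi.single i 1 := fun i => by
          have := hec x' hx'.1 (Pi.single i 1)
          simpa [Pi.single_apply, ite_smul] using this
        have hei' : ∀ i, τ' x' (e' i x') = Pi.single i 1 := fun i => by
          have := hec' x' hx'.2 (Pi.single i 1)
          simpa [Pi.single_apply, ite_smul] using this
        rw [map_sum]
        ext ⟨i, j⟩
        have hsm : ∀ (c : ℂ) (v : E.Fiber x') (w : E'.Fiber x'), (B.toLinearMap ∘ₗ
            TensorProduct.map (τ x') (τ' x')) ((c • v) ⊗ₜ w) = c • (B.toLinearMap ∘ₗ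
            TensorProduct.map (τ x') (τ' x')) (v ⊗ₜ w) := fun c v w => by
          rw [← TensorProduct.smul_tmul', map_smul]
        simp only [hsm, Finset.sum_apply, Pi.smul_apply]
        have : ∀ p : ι × ι', (B.toLinearMap ∘ₗ TensorProduct.map (τ x') (τ' x'))
            (e p.1 x' ⊗ₜ e' p.2 x') (i, j) = if p = (i, j) then 1 else 0 := by
          rintro ⟨p, q⟩
          simp only [LinearMap.comp_apply, TensorProduct.map_tmul, LinearEquiv.coe_coe, hB, hei,
            hei', Pi.single_apply, Prod.mk.injEq]
          grind
        simp only [this]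
        simp

variable {Z : Type u} [TopologicalSpace Z] {T : SmoothFunctions Z}

/-- The pullback bundle `f^* E` along a smooth map; a section is smooth if locally it is a finite
combination, with smooth coefficients, of sections `σ ∘ f` with `σ` a smooth section of `E`. -/
@[reducible]
def pullback {f : Z → X} (hf : SmoothFunctions.IsSmoothMap T S f) (E : SmoothBundle S) :
    SmoothBundle T where
  Fiber z := E.Fiber (f z)
  SmoothAt t z := ∃ (κ : Type) (_ : Fintype κ) (c : κ → Z → ℂ) (σ : κ → ∀ x, E.Fiber x),
    (∀ k, T.SmoothAt (c k) z) ∧ (∀ k, E.SmoothAt (σ k) (f z)) ∧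
      ∀ᶠ z' in 𝓝 z, t z' = ∑ k, c k z' • σ k (f z')
  locallyTrivial z₀ := by
    classical
    obtain ⟨U, ι, hι, τ, hx, hτ⟩ := E.locallyTrivial (f z₀)
    have := Fintype.ofFinite ι
    obtain ⟨e, he, hev, hec⟩ := hτ.exists_frame
    refine ⟨f ⁻¹' U, ι, hι, fun z => τ (f z), hx, hτ.isOpen.preimage hf.continuous,
      fun z hz => hτ.bijective _ hz, fun t z hz => ⟨?_, fun h => ?_⟩⟩
    · rintro ⟨κ, _, c, σ, hc, hσ, ht⟩ i
      refine T.congr (T.sum Finset.univ fun k _ => T.mul (hc k)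
        (hf.comp _ _ ((hτ.smoothAt_iff _ _ hz).1 (hσ k) i))) ?_
      filter_upwards [ht] with z' hz'
      simp [hz']
    · refine ⟨ι, inferInstance, fun i z => τ (f z) (t z) i, e, h, fun i => he i _ hz, ?_⟩
      filter_upwards [(hτ.isOpen.preimage hf.continuous).mem_nhds hz] with z' hz'
      exact hev _ hz' (t z')

end Constructions

end SmoothBundle

/-! ### Surjective submersions and their fibre products -/

namespace SmoothFunctions.IsSmoothMap

variable {X Z W : Type u} [TopologicalSpace X] [TopologicalSpace Z] [TopologicalSpace W]
  {S : SmoothFunctions X} {T : SmoothFunctions Z} {R : SmoothFunctions W}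

lemma of_induced (ι : Z → X) (hι : Continuous ι) : IsSmoothMap (S.induced ι hι) S ι where
  continuous := hι
  comp g _ hg := ⟨g, hg, EventuallyEq.rfl⟩

lemma comp_map {g : X → Z} {f : W → X} (hg : IsSmoothMap S T g) (hf : IsSmoothMap R S f) :
    IsSmoothMap R T (g ∘ f) where
  continuous := hg.continuous.comp hf.continuous
  comp k _ hk := hf.comp (k ∘ g) _ (hg.comp k _ hk)

lemma to_induced {ι : Z → X} {hι : Continuous ι} {f : W → Z} (hf : Continuous f)
    (h : IsSmoothMap R S (ι ∘ f)) : IsSmoothMap R (S.induced ι hι) f where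
  continuous := hf
  comp g x := by
    rintro ⟨g', hg', hgg'⟩
    exact R.congr (h.comp g' x hg') (hf.continuousAt.eventually hgg'.symm)

lemma of_contMDiff {E H E' H' : Type*} [NormedAddCommGroup E] [NormedSpace ℝ E]
    [TopologicalSpace H] [NormedAddCommGroup E'] [NormedSpace ℝ E'] [TopologicalSpace H']
    {I : ModelWithCorners ℝ E H} {I' : ModelWithCorners ℝ E' H'} [ChartedSpace H X]
    [ChartedSpace H' Z] {f : X → Z} (hf : ContMDiff I I' ∞ f) :
    IsSmoothMap (ofManifold I X) (ofManifold I' Z) f where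
  continuous := hf.continuous
  comp g x hg := by
    filter_upwards [hf.continuous.continuousAt.eventually hg] with x' hx'
    exact ContMDiffAt.comp x' hx' hf.contMDiffAt

end SmoothFunctions.IsSmoothMap

section Submersion

variable {EY EM : Type*} [NormedAddCommGroup EY] [NormedSpace ℝ EY] [NormedAddCommGroup EM]
  [NormedSpace ℝ EM] {Y M : Type u} [TopologicalSpace Y] [ChartedSpace EY Y]
  [TopologicalSpace M] [ChartedSpace EM M]

variable (EY EM Y M) in
/-- A surjective submersion `π : Y → M` of smooth manifolds without boundary, modelled on the vector
spaces `EY` and `EM`. -/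
structure SurjectiveSubmersion where
  π : Y → M
  surjective : Function.Surjective π
  isSubmersion : Manifold.IsSubmersion 𝓘(ℝ, EY) 𝓘(ℝ, EM) ∞ π

namespace SurjectiveSubmersion

variable (p : SurjectiveSubmersion EY EM Y M)

/-- The smooth functions on `M`. -/
@[nolint unusedArguments]
def smoothM (_ : SurjectiveSubmersion EY EM Y M) : SmoothFunctions M :=
  SmoothFunctions.ofManifold 𝓘(ℝ, EM) M

/-- The smooth functions on `Y`. -/
@[nolint unusedArguments]
def smoothY (_ : SurjectiveSubmersion EY EM Y M) : SmoothFunctions Y :=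
  SmoothFunctions.ofManifold 𝓘(ℝ, EY) Y

/-- The fibre product `Y ×_M Y`. -/
abbrev Fib2 : Type u := {q : Y × Y // p.π q.1 = p.π q.2}

/-- The fibre product `Y ×_M Y ×_M Y`. -/
abbrev Fib3 : Type u := {q : Y × Y × Y // p.π q.1 = p.π q.2.1 ∧ p.π q.2.1 = p.π q.2.2}

/-- The smooth functions on the embedded submanifold `Y ×_M Y` of `Y × Y`. -/
def smooth2 : SmoothFunctions p.Fib2 :=
  (SmoothFunctions.ofManifold (𝓘(ℝ, EY).prod 𝓘(ℝ, EY)) (Y × Y)).induced Subtype.val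
    continuous_subtype_val

/-- The smooth functions on the embedded submanifold `Y ×_M Y ×_M Y` of `Y × Y × Y`. -/
def smooth3 : SmoothFunctions p.Fib3 :=
  (SmoothFunctions.ofManifold (𝓘(ℝ, EY).prod (𝓘(ℝ, EY).prod 𝓘(ℝ, EY))) (Y × Y × Y)).induced
    Subtype.val continuous_subtype_val

variable {p} in
/-- The point `(y₁, y₂)` of `Y ×_M Y`. -/
abbrev mk2 {y₁ y₂ : Y} (h : p.π y₁ = p.π y₂) : p.Fib2 := ⟨(y₁, y₂), h⟩

variable {p} in
/-- The point `(y₁, y₂, y₃)` of `Y ×_M Y ×_M Y`. -/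
abbrev mk3 {y₁ y₂ y₃ : Y} (h : p.π y₁ = p.π y₂) (h' : p.π y₂ = p.π y₃) : p.Fib3 :=
  ⟨(y₁, y₂, y₃), h, h'⟩

/-- `π₁ : Y ×_M Y → Y`, omitting the first entry. -/
@[reducible]
def pr1 (q : p.Fib2) : Y := q.1.2

/-- `π₂ : Y ×_M Y → Y`, omitting the second entry. -/
@[reducible]
def pr2 (q : p.Fib2) : Y := q.1.1

/-- `π₁ : Y ×_M Y ×_M Y → Y ×_M Y`, omitting the first entry. -/
@[reducible]
def omit1 (q : p.Fib3) : p.Fib2 := mk2 q.2.2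

/-- `π₂ : Y ×_M Y ×_M Y → Y ×_M Y`, omitting the second entry. -/
@[reducible]
def omit2 (q : p.Fib3) : p.Fib2 := mk2 (q.2.1.trans q.2.2)

/-- `π₃ : Y ×_M Y ×_M Y → Y ×_M Y`, omitting the third entry. -/
@[reducible]
def omit3 (q : p.Fib3) : p.Fib2 := mk2 q.2.1

open SmoothFunctions

lemma pr1_smooth : IsSmoothMap p.smooth2 p.smoothY p.pr1 :=
  (IsSmoothMap.of_contMDiff contMDiff_snd).comp_map (IsSmoothMap.of_induced _ _)

lemma pr2_smooth : IsSmoothMap p.smooth2 p.smoothY p.pr2 :=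
  (IsSmoothMap.of_contMDiff contMDiff_fst).comp_map (IsSmoothMap.of_induced _ _)

lemma omit1_smooth : IsSmoothMap p.smooth3 p.smooth2 p.omit1 := by
  have h : IsSmoothMap p.smooth3 (ofManifold (𝓘(ℝ, EY).prod 𝓘(ℝ, EY)) (Y × Y))
      (Subtype.val ∘ p.omit1) :=
    (IsSmoothMap.of_contMDiff (f := fun q : Y × Y × Y => (q.2.1, q.2.2))
      ((contMDiff_fst.comp contMDiff_snd).prodMk (contMDiff_snd.comp contMDiff_snd))).comp_map
      (IsSmoothMap.of_induced _ _)
  exact IsSmoothMap.to_induced (continuous_induced_rng.2 h.continuous) h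

lemma omit2_smooth : IsSmoothMap p.smooth3 p.smooth2 p.omit2 := by
  have h : IsSmoothMap p.smooth3 (ofManifold (𝓘(ℝ, EY).prod 𝓘(ℝ, EY)) (Y × Y))
      (Subtype.val ∘ p.omit2) :=
    (IsSmoothMap.of_contMDiff (f := fun q : Y × Y × Y => (q.1, q.2.2))
      (contMDiff_fst.prodMk (contMDiff_snd.comp contMDiff_snd))).comp_map
      (IsSmoothMap.of_induced _ _)
  exact IsSmoothMap.to_induced (continuous_induced_rng.2 h.continuous) h

lemma omit3_smooth : IsSmoothMap p.smooth3 p.smooth2 p.omit3 := by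
  have h : IsSmoothMap p.smooth3 (ofManifold (𝓘(ℝ, EY).prod 𝓘(ℝ, EY)) (Y × Y))
      (Subtype.val ∘ p.omit3) :=
    (IsSmoothMap.of_contMDiff (f := fun q : Y × Y × Y => (q.1, q.2.1))
      (contMDiff_fst.prodMk (contMDiff_fst.comp contMDiff_snd))).comp_map
      (IsSmoothMap.of_induced _ _)
  exact IsSmoothMap.to_induced (continuous_induced_rng.2 h.continuous) h

lemma contMDiff : ContMDiff 𝓘(ℝ, EY) 𝓘(ℝ, EM) ∞ p.π := p.isSubmersion.contMDiff

lemma π_smooth : IsSmoothMap p.smoothY p.smoothM p.π := IsSmoothMap.of_contMDiff p.contMDiff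

/-- A submersion has smooth local sections through each point. -/
lemma exists_section (y₀ : Y) : ∃ (W : Set M) (σ : M → Y), IsOpen W ∧ p.π y₀ ∈ W ∧
    σ (p.π y₀) = y₀ ∧ (∀ m ∈ W, p.π (σ m) = m) ∧ ContMDiffOn 𝓘(ℝ, EM) 𝓘(ℝ, EY) ∞ σ W := by
  obtain ⟨F, _, _, hF⟩ := p.isSubmersion
  obtain ⟨φ, ψ, hy, hm, hφ, hψ, hsub, e, he⟩ := hF y₀
  have he' : ∀ u ∈ φ.target, ψ (p.π (φ.symm u)) = (e u).1 := fun u hu => by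
    have := he (x := u) (by simpa using hu)
    simpa using this
  let g : EM → EY := fun v => e.symm (v, (e (φ y₀)).2)
  have hg : ContMDiff 𝓘(ℝ, EM) 𝓘(ℝ, EY) ∞ g := by
    rw [contMDiff_iff_contDiff]
    exact e.symm.contDiff.comp (contDiff_id.prodMk contDiff_const)
  have h0 : g (ψ (p.π y₀)) = φ y₀ := by
    have := he' (φ y₀) (φ.map_source hy)
    rw [φ.left_inv hy] at this
    simp only [g, this]
    simp
  refine ⟨ψ.source ∩ ψ ⁻¹' (g ⁻¹' φ.target), fun m => φ.symm (g (ψ m)),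
    ψ.isOpen_inter_preimage (φ.open_target.preimage hg.continuous), ⟨hm, ?_⟩, ?_, ?_, ?_⟩
  · show g (ψ (p.π y₀)) ∈ φ.target
    rw [h0]
    exact φ.map_source hy
  · show φ.symm (g (ψ (p.π y₀))) = y₀
    rw [h0, φ.left_inv hy]
  · rintro m ⟨hm1, hm2⟩
    apply ψ.injOn (hsub (φ.map_target hm2)) hm1
    rw [he' _ hm2]
    simp [g]
  · refine (contMDiffOn_symm_of_mem_maximalAtlas hφ).comp
      ((hg.comp_contMDiffOn (contMDiffOn_of_mem_maximalAtlas hψ)).mono inter_subset_left) ?_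
    rintro m ⟨hm1, hm2⟩
    exact hm2

end SurjectiveSubmersion

/-! ### Descent data and the descended bundle -/

open SmoothBundle SurjectiveSubmersion

variable (p : SurjectiveSubmersion EY EM Y M)

/-- An object `(E, φ)` of the descent category of vector bundles for `Y → M`: a vector bundle `E` on
`Y` with an isomorphism `φ : π₁^* E → π₂^* E` over `Y ×_M Y`, i.e. a smooth family of isomorphisms
`φ_(y₁, y₂) : E_{y₂} → E_{y₁}`, satisfying `π₂^* φ = π₃^* φ ∘ π₁^* φ` over `Y ×_M Y ×_M Y`. -/
structure DescentDatum where
  E : SmoothBundle p.smoothY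
  φ : Iso (pullback p.pr1_smooth E) (pullback p.pr2_smooth E)
  cocycle : ∀ {y₁ y₂ y₃ : Y} (h : p.π y₁ = p.π y₂) (h' : p.π y₂ = p.π y₃) (v : E.Fiber y₃),
    φ.map (mk2 (h.trans h')) v = φ.map (mk2 h) (φ.map (mk2 h') v)

namespace DescentDatum

variable {p}

/-- The isomorphism `φ_(y₁, y₂) : E_{y₂} → E_{y₁}`. -/
def tr (D : DescentDatum p) {y₁ y₂ : Y} (h : p.π y₁ = p.π y₂) : D.E.Fiber y₂ ≃ₗ[ℂ] D.E.Fiber y₁ :=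
  D.φ.map (mk2 h)

lemma tr_tr (D : DescentDatum p) {y₁ y₂ y₃ : Y} (h : p.π y₁ = p.π y₂) (h' : p.π y₂ = p.π y₃)
    (v : D.E.Fiber y₃) : D.tr h (D.tr h' v) = D.tr (h.trans h') v := (D.cocycle h h' v).symm

lemma tr_self (D : DescentDatum p) {y : Y} (h : p.π y = p.π y) (v : D.E.Fiber y) :
    D.tr h v = v := (D.tr h).injective (D.tr_tr h h v)

/-- Morphisms of the descent category. -/
@[ext]
structure Hom (D D' : DescentDatum p) where
  f : SmoothBundle.Hom D.E D'.E
  comm : ∀ {y₁ y₂ : Y} (h : p.π y₁ = p.π y₂) (v : D.E.Fiber y₂),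
    f.map y₁ (D.tr h v) = D'.tr h (f.map y₂ v)

/-- The fibre at `m` of the descended bundle: the families of vectors in the fibres `E_y`, `y` over
`m`, that are compatible with the descent isomorphisms. -/
def descendFiber (D : DescentDatum p) (m : M) :
    Submodule ℂ (∀ y : {y : Y // p.π y = m}, D.E.Fiber y) where
  carrier := {v | ∀ y₁ y₂ : {y : Y // p.π y = m}, D.tr (y₁.2.trans y₂.2.symm) (v y₂) = v y₁}
  add_mem' h h' y₁ y₂ := by simp [h y₁ y₂, h' y₁ y₂]
  zero_mem' y₁ y₂ := by simp
  smul_mem' c v h y₁ y₂ := by simp [h y₁ y₂]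

/-- The section of `E` over `Y` defined by a section of the descended family over `M`. -/
def lift (D : DescentDatum p) (s : ∀ m, D.descendFiber m) (y : Y) : D.E.Fiber y :=
  (s (p.π y)).1 ⟨y, rfl⟩

lemma lift_eq (D : DescentDatum p) (s : ∀ m, D.descendFiber m) {m : M} {y : Y} (h : p.π y = m) :
    (s m).1 ⟨y, h⟩ = D.lift s y := by
  subst h; rfl

lemma tr_lift (D : DescentDatum p) (s : ∀ m, D.descendFiber m) {y₁ y₂ : Y} (h : p.π y₁ = p.π y₂) :
    D.tr h (D.lift s y₂) = D.lift s y₁ := by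
  have := (s (p.π y₂)).2 ⟨y₁, h⟩ ⟨y₂, rfl⟩
  rw [D.lift_eq s h] at this
  exact this

/-- Auxiliary: smoothness of the section of `E` obtained by transporting `D.lift s` along a local
section of the submersion. -/
lemma smoothAt_lift_of_transport (D : DescentDatum p) (s : ∀ m, D.descendFiber m) {W : Set M}
    {σ : M → Y} (hW : IsOpen W) (hσ : ∀ m ∈ W, p.π (σ m) = m)
    (hσs : ContMDiffOn 𝓘(ℝ, EM) 𝓘(ℝ, EY) ∞ σ W) {y : Y} (hy : p.π y ∈ W)
    {κ : Type} [Fintype κ] (c : κ → M → ℂ) (e : κ → ∀ y, D.E.Fiber y)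
    (hc : ∀ k, p.smoothM.SmoothAt (c k) (p.π y)) (he : ∀ k, D.E.SmoothAt (e k) (σ (p.π y)))
    (hs : ∀ᶠ m in 𝓝 (p.π y), D.lift s (σ m) = ∑ k, c k m • e k (σ m)) :
    D.E.SmoothAt (D.lift s) y := by
  classical
  have hWy : ∀ᶠ y' in 𝓝 y, p.π y' ∈ W := p.contMDiff.continuous.continuousAt (hW.mem_nhds hy)
  -- the map `y' ↦ (y', σ (π y'))`
  let q : Y → p.Fib2 := fun y' => if h : p.π y' ∈ W then mk2 (hσ _ h).symm else mk2 (y₁ := y') (y₂ := y') rfl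
  have hq : ∀ y', p.π y' ∈ W → (q y').1 = (y', σ (p.π y')) := fun y' h => by
    simp only [q, dif_pos h]
  have hq2 : ∀ y', p.pr2 (q y') = y' := fun y' => by
    by_cases h : p.π y' ∈ W
    · simp only [pr2, hq y' h]
    · simp only [q, dif_neg h, pr2]
  have hcm : ∀ y', p.π y' ∈ W → ContMDiffAt 𝓘(ℝ, EY) (𝓘(ℝ, EY).prod 𝓘(ℝ, EY)) ∞
      (fun y' => (y', σ (p.π y'))) y' := fun y' h =>
    contMDiffAt_id.prodMk (((hσs.contMDiffAt (hW.mem_nhds h))).comp y' p.contMDiff.contMDiffAt)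
  have hqc : ContinuousAt q y := by
    refine (Topology.IsInducing.subtypeVal
      (t := {q : Y × Y | p.π q.1 = p.π q.2})).continuousAt_iff.2 ?_
    exact (hcm y hy).continuousAt.congr (hWy.mono fun y' h => (hq y' h).symm)
  have hqs : ∀ d : p.Fib2 → ℂ, p.smooth2.SmoothAt d (q y) → p.smoothY.SmoothAt (d ∘ q) y := by
    rintro d ⟨g, hg, hdg⟩
    rw [hq y hy] at hg
    have h1 : ∀ᶠ y' in 𝓝 y, ContMDiffAt 𝓘(ℝ, EY) 𝓘(ℝ, ℂ) ∞ (fun y' => g (y', σ (p.π y'))) y' := by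
      filter_upwards [(hcm y hy).continuousAt.eventually hg, hWy] with y' h h'
      exact ContMDiffAt.comp y' h (hcm y' h')
    refine p.smoothY.congr (f := fun y' => g (y', σ (p.π y'))) h1 ?_
    filter_upwards [hqc.eventually hdg, hWy] with y' h h'
    simp only [Function.comp_apply] at h ⊢
    rw [h, hq y' h']
  -- the section of `π₁^* E` to be transported
  let t : ∀ z, (pullback p.pr1_smooth D.E).Fiber z := fun z =>
    ∑ k, c k (p.π (p.pr1 z)) • e k (p.pr1 z)
  have hpr : p.pr1 (q y) = σ (p.π y) := by simp only [pr1, hq y hy]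
  have ht : (pullback p.pr1_smooth D.E).SmoothAt t (q y) := by
    refine ⟨κ, inferInstance, fun k z => c k (p.π (p.pr1 z)), e, fun k => ?_, fun k => ?_, ?_⟩
    · refine p.pr1_smooth.comp (c k ∘ p.π) _ (p.π_smooth.comp (c k) _ ?_)
      rw [hpr, hσ _ hy]
      exact hc k
    · rw [hpr]
      exact he k
    · exact Eventually.of_forall fun z => rfl
  obtain ⟨κ', _, d, σ', hd, hσ', hsum⟩ := D.φ.smooth t (q y) ht
  refine D.E.smoothAt_congr (D.E.smoothAt_sum Finset.univ fun k _ =>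
    D.E.smoothAt_smul (hqs _ (hd k)) (by simpa only [hq2] using hσ' k)) ?_
  filter_upwards [hqc.eventually hsum, hWy,
    p.contMDiff.continuous.continuousAt.eventually hs] with y' h1 h2 h3
  have hqy : q y' = mk2 (hσ _ h2).symm := by simp only [q, dif_pos h2]
  rw [hqy] at h1
  have h4 : D.tr (hσ _ h2).symm (D.lift s (σ (p.π y'))) = D.lift s y' := D.tr_lift s _
  rw [← h4, h3]
  have h5 : t (mk2 (hσ _ h2).symm) = ∑ k, c k (p.π y') • e k (σ (p.π y')) := by
    simp only [t, pr1, hσ _ h2]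
  simp only [Function.comp_apply, hqy]
  exact h1.symm.trans (by rw [h5]; rfl)

/-- The vector bundle on `M` defined by a descent datum; a section of it is smooth if the
corresponding section of `E` over `Y` is smooth. -/
@[reducible]
def descend (D : DescentDatum p) : SmoothBundle p.smoothM where
  Fiber m := D.descendFiber m
  SmoothAt s m := ∀ y, p.π y = m → D.E.SmoothAt (D.lift s) y
  locallyTrivial m₀ := by
    classical
    obtain ⟨y₀, rfl⟩ := p.surjective m₀
    obtain ⟨W, σ, hW, hmW, hσ0, hσ, hσs⟩ := p.exists_section y₀
    obtain ⟨U, ι, hι, τ, hU, hτ⟩ := D.E.locallyTrivial y₀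
    have := Fintype.ofFinite ι
    obtain ⟨e, he, hev, hec⟩ := hτ.exists_frame
    have hopen : IsOpen (W ∩ σ ⁻¹' U) := hσs.continuousOn.isOpen_inter_preimage hW hτ.isOpen
    let T : ∀ m, D.descendFiber m →ₗ[ℂ] (ι → ℂ) := fun m =>
      if h : m ∈ W then τ (σ m) ∘ₗ LinearMap.proj (⟨σ m, hσ m h⟩ : {y : Y // p.π y = m}) ∘ₗ
        (D.descendFiber m).subtype else 0
    have hT : ∀ (s : ∀ m, D.descendFiber m) (m) (_ : m ∈ W),
        T m (s m) = τ (σ m) (D.lift s (σ m)) := fun s m h => by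
      simp only [T, dif_pos h, LinearMap.comp_apply, LinearMap.proj_apply, Submodule.subtype_apply]
      rw [← D.lift_eq s (hσ m h)]
    refine ⟨W ∩ σ ⁻¹' U, ι, hι, T, ⟨hmW, by simpa [hσ0] using hU⟩, hopen, ?_, ?_⟩
    · rintro m ⟨hm, hmU⟩
      simp only [T, dif_pos hm]
      constructor
      · intro v w hvw
        have h0 := (hτ.bijective _ hmU).1 hvw
        simp only [LinearMap.comp_apply, LinearMap.proj_apply, Submodule.subtype_apply] at h0
        ext y
        rw [← v.2 y ⟨σ m, hσ m hm⟩, ← w.2 y ⟨σ m, hσ m hm⟩, h0]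
      · intro c
        obtain ⟨v, hv⟩ := (hτ.bijective _ hmU).2 c
        refine ⟨⟨fun y => D.tr (y.2.trans (hσ m hm).symm) v, fun y₁ y₂ => D.tr_tr _ _ v⟩, ?_⟩
        simp only [LinearMap.comp_apply, LinearMap.proj_apply, Submodule.subtype_apply, tr_self]
        exact hv
    · rintro s m ⟨hm, hmU⟩
      have hσm : ∀ f, p.smoothY.SmoothAt f (σ m) → p.smoothM.SmoothAt (f ∘ σ) m := by
        intro f hf
        have h1 : ∀ᶠ m' in 𝓝 m, ContMDiffAt 𝓘(ℝ, EY) 𝓘(ℝ, ℂ) ∞ f (σ m') :=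
          (hσs.continuousOn.continuousAt (hW.mem_nhds hm)).eventually hf
        show ∀ᶠ m' in 𝓝 m, ContMDiffAt 𝓘(ℝ, EM) 𝓘(ℝ, ℂ) ∞ (f ∘ σ) m'
        filter_upwards [h1, hW.mem_nhds hm] with m' h h'
        exact h.comp m' (hσs.contMDiffAt (hW.mem_nhds h'))
      constructor
      · intro h i
        refine p.smoothM.congr (hσm _ ((hτ.smoothAt_iff _ _ hmU).1 (h (σ m) (hσ m hm)) i)) ?_
        filter_upwards [hW.mem_nhds hm] with m' hm'
        simp [hT s m' hm']
      · rintro h y rfl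
        refine D.smoothAt_lift_of_transport s hW hσ hσs hm (fun i m => T m (s m) i) e h
          (fun i => he i _ hmU) ?_
        filter_upwards [hopen.mem_nhds ⟨hm, hmU⟩] with m' hm'
        simp only [hT s m' hm'.1]
        exact hev _ hm'.2 _

/-- The descended bundle is functorial. -/
def descendMap {D D' : DescentDatum p} (F : Hom D D') :
    SmoothBundle.Hom D.descend D'.descend where
  map m :=
    { toFun := fun v => ⟨fun y => F.f.map y (v.1 y), fun y₁ y₂ => by
        rw [← F.comm, v.2 y₁ y₂]⟩
      map_add' := fun v w => Subtype.ext (funext fun y => map_add _ _ _)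
      map_smul' := fun c v => Subtype.ext (funext fun y => map_smul _ _ _) }
  smooth s _ hs y hy := F.f.smooth _ y (hs y hy)

end DescentDatum

/-! ### Bundle gerbes and gerbe modules -/

/-- A hermitian vector bundle: a smooth complex vector bundle with a smooth family of positive
definite hermitian forms on the fibres. -/
structure HermitianBundle {X : Type u} [TopologicalSpace X] (S : SmoothFunctions X) extends
    SmoothBundle S where
  metric : ∀ x, InnerProductSpace.Core ℂ (Fiber x)
  metric_smooth : ∀ s t x, SmoothAt s x → SmoothAt t x →
    S.SmoothAt (fun x' => (metric x').inner (s x') (t x')) x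

/-- A bundle gerbe `(Y, L, μ)` over `M`, with surjective submersion `p : Y → M`: a hermitian line
bundle `L` over `Y ×_M Y` and a bundle isomorphism `μ : π₃^* L ⊗ π₁^* L → π₂^* L` over
`Y ×_M Y ×_M Y`, that is `L_(y₁, y₂) ⊗ L_(y₂, y₃) → L_(y₁, y₃)`, which is associative over
`Y ×_M Y ×_M Y ×_M Y`. -/
structure BundleGerbe where
  L : HermitianBundle p.smooth2
  finrank_eq_one : ∀ z, Module.finrank ℂ (L.Fiber z) = 1
  μ : Iso (tensor (pullback p.omit3_smooth L.toSmoothBundle)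
    (pullback p.omit1_smooth L.toSmoothBundle)) (pullback p.omit2_smooth L.toSmoothBundle)
  assoc : ∀ {y₁ y₂ y₃ y₄ : Y} (h : p.π y₁ = p.π y₂) (h' : p.π y₂ = p.π y₃) (h'' : p.π y₃ = p.π y₄)
    (a : L.Fiber (mk2 h)) (b : L.Fiber (mk2 h')) (c : L.Fiber (mk2 h'')),
    μ.map (mk3 (h.trans h') h'') (μ.map (mk3 h h') (a ⊗ₜ[ℂ] b) ⊗ₜ[ℂ] c) =
      μ.map (mk3 h (h'.trans h'')) (a ⊗ₜ[ℂ] μ.map (mk3 h' h'') (b ⊗ₜ[ℂ] c))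

variable {p}

/-- A gerbe module `(E, ρ)`: a hermitian vector bundle `E` on `Y` and an isomorphism of hermitian
vector bundles `ρ : L ⊗ π₁^* E → π₂^* E` over `Y ×_M Y`, that is `L_(y₁, y₂) ⊗ E_{y₂} → E_{y₁}`,
compatible with `μ` over `Y ×_M Y ×_M Y`.  Unitarity of `ρ` refers to the tensor product metric
`⟨a ⊗ v, a' ⊗ v'⟩ = ⟨a, a'⟩ ⟨v, v'⟩`. -/
structure GerbeModule (G : BundleGerbe p) where
  E : HermitianBundle p.smoothY
  ρ : Iso (tensor G.L.toSmoothBundle (pullback p.pr1_smooth E.toSmoothBundle))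
    (pullback p.pr2_smooth E.toSmoothBundle)
  unitary : ∀ {y₁ y₂ : Y} (h : p.π y₁ = p.π y₂) (a a' : G.L.Fiber (mk2 h)) (v v' : E.Fiber y₂),
    (E.metric y₁).inner (ρ.map (mk2 h) (a ⊗ₜ[ℂ] v)) (ρ.map (mk2 h) (a' ⊗ₜ[ℂ] v')) =
      (G.L.metric (mk2 h)).inner a a' * (E.metric y₂).inner v v'
  compat : ∀ {y₁ y₂ y₃ : Y} (h : p.π y₁ = p.π y₂) (h' : p.π y₂ = p.π y₃)
    (a : G.L.Fiber (mk2 h)) (b : G.L.Fiber (mk2 h')) (v : E.Fiber y₃),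
    ρ.map (mk2 h) (a ⊗ₜ[ℂ] ρ.map (mk2 h') (b ⊗ₜ[ℂ] v)) =
      ρ.map (mk2 (h.trans h')) (G.μ.map (mk3 h h') (a ⊗ₜ[ℂ] b) ⊗ₜ[ℂ] v)

namespace GerbeModule

variable {G : BundleGerbe p}

/-- The underlying smooth vector bundle on `Y`. -/
abbrev bundle (N : GerbeModule G) : SmoothBundle p.smoothY := N.E.toSmoothBundle

/-- The isomorphism `ρ` over the point `(y₁, y₂)`. -/
def act (N : GerbeModule G) {y₁ y₂ : Y} (h : p.π y₁ = p.π y₂) :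
    (G.L.Fiber (mk2 h) ⊗[ℂ] N.bundle.Fiber y₂) ≃ₗ[ℂ] N.bundle.Fiber y₁ :=
  N.ρ.map (mk2 h)

lemma act_act (N : GerbeModule G) {y₁ y₂ y₃ : Y} (h : p.π y₁ = p.π y₂) (h' : p.π y₂ = p.π y₃)
    (a : G.L.Fiber (mk2 h)) (b : G.L.Fiber (mk2 h')) (v : N.bundle.Fiber y₃) :
    N.act h (a ⊗ₜ N.act h' (b ⊗ₜ v)) =
      N.act (h.trans h') (G.μ.map (mk3 h h') (a ⊗ₜ[ℂ] b) ⊗ₜ v) :=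
  N.compat h h' a b v

/-- The morphisms of gerbe modules: the smooth families of linear maps `f_y : E_y → E'_y` with
`π₂^* f ∘ ρ = ρ' ∘ (id ⊗ π₁^* f)`. -/
def homs (N P : GerbeModule G) :
    Submodule ℂ (∀ y, N.bundle.Fiber y →ₗ[ℂ] P.bundle.Fiber y) where
  carrier := {f |
    (∀ s y, N.bundle.SmoothAt s y → P.bundle.SmoothAt (fun y' => f y' (s y')) y) ∧
    ∀ {y₁ y₂ : Y} (h : p.π y₁ = p.π y₂) (a : G.L.Fiber (mk2 h)) (v : N.bundle.Fiber y₂),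
      f y₁ (N.act h (a ⊗ₜ v)) = P.act h (a ⊗ₜ f y₂ v)}
  add_mem' := by
    rintro f g ⟨hf, hf'⟩ ⟨hg, hg'⟩
    refine ⟨fun s y hs => P.bundle.smoothAt_add (hf s y hs) (hg s y hs), fun h a v => ?_⟩
    simp only [Pi.add_apply, LinearMap.add_apply, hf' h a v, hg' h a v, tmul_add, map_add]
  zero_mem' := ⟨fun s y hs => P.bundle.smoothAt_zero y, fun h a v => by simp⟩
  smul_mem' := by
    rintro c f ⟨hf, hf'⟩
    refine ⟨fun s y hs => P.bundle.smoothAt_smul (SmoothFunctions.const _ c y) (hf s y hs),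
      fun h a v => ?_⟩
    simp only [Pi.smul_apply, LinearMap.smul_apply, hf' h a v, tmul_smul, map_smul]

/-- The category of gerbe modules over a bundle gerbe. -/
instance : Category (GerbeModule G) where
  Hom N P := homs N P
  id N := ⟨fun _ => LinearMap.id, fun _ _ hs => hs, fun _ _ _ => rfl⟩
  comp f g := ⟨fun y => g.1 y ∘ₗ f.1 y, fun s y hs => g.2.1 _ y (f.2.1 s y hs), fun h a v => by
    simp only [LinearMap.comp_apply, f.2.2 h a v, g.2.2 h]⟩

/-- The linear map on the fibres at `y` of a morphism of gerbe modules. -/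
def fiberMap {N P : GerbeModule G} (f : N ⟶ P) (y : Y) :
    N.bundle.Fiber y →ₗ[ℂ] P.bundle.Fiber y := f.1 y

instance (N P : GerbeModule G) : AddCommGroup (N ⟶ P) := inferInstanceAs (AddCommGroup (homs N P))

instance (N P : GerbeModule G) : Module ℂ (N ⟶ P) := inferInstanceAs (Module ℂ (homs N P))

instance : Preadditive (GerbeModule G) where
  homGroup _ _ := inferInstance
  add_comp _ _ _ _ _ _ := Subtype.ext (funext fun _ => LinearMap.comp_add _ _ _)
  comp_add _ _ _ _ _ _ := Subtype.ext (funext fun _ => LinearMap.add_comp _ _ _)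

instance : Linear ℂ (GerbeModule G) where
  homModule _ _ := inferInstance
  smul_comp _ _ _ _ _ _ := Subtype.ext (funext fun _ => LinearMap.comp_smul _ _ _)
  comp_smul _ _ _ _ _ _ := Subtype.ext (funext fun _ => LinearMap.smul_comp _ _ _)

/-- The gerbe module is nontrivial: it is not zero over any connected component of `M`. -/
def IsNontrivial (N : GerbeModule G) : Prop :=
  ∀ m : M, ∃ y : Y, p.π y ∈ connectedComponent m ∧ Nontrivial (N.bundle.Fiber y)

end GerbeModule

/-! ### The descent datum on `Hom(E, E')` -/

section LinearAlgebra

variable {L V W : Type u} [AddCommGroup L] [Module ℂ L] [AddCommGroup V] [Module ℂ V]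
  [AddCommGroup W] [Module ℂ W]

/-- For a line `L`, the canonical isomorphism `Hom(V, W) ≃ Hom(L ⊗ V, L ⊗ W)`, `β ↦ id ⊗ β`; its
inverse is the contraction `V^* ⊗ L^* ⊗ L ⊗ W → V^* ⊗ W`. -/
def lineHomEquiv (hL : Module.finrank ℂ L = 1) :
    (V →ₗ[ℂ] W) ≃ₗ[ℂ] (L ⊗[ℂ] V →ₗ[ℂ] L ⊗[ℂ] W) :=
  LinearEquiv.ofBijective (LinearMap.lTensorHom L) (by
    obtain ⟨e⟩ : Nonempty (L ≃ₗ[ℂ] ℂ) := by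
      have : FiniteDimensional ℂ L := Module.finite_of_finrank_eq_succ hL
      exact ⟨LinearEquiv.ofFinrankEq _ _ (by simpa using hL)⟩
    have h : ∀ β : V →ₗ[ℂ] W, ∀ v, (TensorProduct.lid ℂ W ∘ₗ TensorProduct.map e.toLinearMap
        LinearMap.id) (β.lTensor L (e.symm 1 ⊗ₜ v)) = β v := fun β v => by simp
    have hL1 : ∀ a : L, a = e a • e.symm 1 := fun a => by
      rw [← map_smul]
      simp
    constructor
    · intro β β' hβ
      ext v
      rw [← h β v, ← h β' v]
      exact congrArg _ (LinearMap.congr_fun hβ _)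
    · intro γ
      refine ⟨TensorProduct.lid ℂ W ∘ₗ TensorProduct.map e.toLinearMap LinearMap.id ∘ₗ γ ∘ₗ
        TensorProduct.mk ℂ L V (e.symm 1), ?_⟩
      have key : ∀ t : L ⊗[ℂ] W, e.symm 1 ⊗ₜ[ℂ] (TensorProduct.lid ℂ W
          (TensorProduct.map e.toLinearMap LinearMap.id t)) = t := fun t => by
        induction t using TensorProduct.induction_on with
        | zero => simp
        | tmul a w =>
          conv_rhs => rw [hL1 a]
          simp [smul_tmul]
        | add x y hx hy => simp only [map_add, tmul_add, hx, hy]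
      ext a v
      rw [hL1 a]
      simp [key])

@[simp]
lemma lineHomEquiv_apply (hL : Module.finrank ℂ L = 1) (β : V →ₗ[ℂ] W) :
    lineHomEquiv hL β = β.lTensor L := rfl

end LinearAlgebra

namespace SmoothBundle

variable {X : Type u} [TopologicalSpace X] {S : SmoothFunctions X}

/-- A section of the pullback of a homomorphism bundle is smooth if it preserves smoothness. -/
lemma smoothAt_pullback_homBundle {Z : Type u} [TopologicalSpace Z] {T : SmoothFunctions Z}
    {f : Z → X} (hf : SmoothFunctions.IsSmoothMap T S f) (E E' : SmoothBundle S)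
    (β : ∀ z, E.Fiber (f z) →ₗ[ℂ] E'.Fiber (f z)) (z : Z) :
    (pullback hf (homBundle E E')).SmoothAt β z ↔ ∀ s, (pullback hf E).SmoothAt s z →
      (pullback hf E').SmoothAt (fun z' => β z' (s z')) z := by
  classical
  constructor
  · rintro ⟨κ, _, c, b, hc, hb, hβ⟩ s ⟨κ', _, d, σ, hd, hσ, hs⟩
    let b' : κ → ∀ x, E.Fiber x →ₗ[ℂ] E'.Fiber x := b
    refine ⟨κ × κ', inferInstance, fun k z' => c k.1 z' * d k.2 z', fun k x => b' k.1 x (σ k.2 x),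
      fun k => T.mul (hc k.1) (hd k.2), fun k => hb k.1 _ (hσ k.2), ?_⟩
    filter_upwards [hβ, hs] with z' h h'
    have h1 : β z' (s z') = (∑ k, c k z' • b' k (f z') : E.Fiber (f z') →ₗ[ℂ] E'.Fiber (f z'))
        (∑ k, d k z' • σ k (f z')) := by
      rw [← h']
      exact LinearMap.congr_fun h _
    rw [h1, Fintype.sum_prod_type, LinearMap.sum_apply]
    refine Finset.sum_congr rfl fun i _ => ?_
    rw [LinearMap.smul_apply, map_sum, Finset.smul_sum]
    refine Finset.sum_congr rfl fun j _ => ?_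
    rw [map_smul, smul_smul]
  · intro h
    obtain ⟨U, ι, hι, τ, hx, hτ⟩ := E.locallyTrivial (f z)
    obtain ⟨U', ι', hι', τ', hx', hτ'⟩ := E'.locallyTrivial (f z)
    have := Fintype.ofFinite ι
    have := Fintype.ofFinite ι'
    obtain ⟨e, he, hev, hec⟩ := hτ.exists_frame
    obtain ⟨e', he', hev', hec'⟩ := hτ'.exists_frame
    have hβe : ∀ i, (pullback hf E').SmoothAt (fun z' => β z' (e i (f z'))) z := fun i =>
      h (fun z' => e i (f z')) ⟨Unit, inferInstance, fun _ _ => 1, fun _ => e i,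
        fun _ => T.const 1 z, fun _ => he i _ hx, Eventually.of_forall fun z' => by simp⟩
    refine ⟨ι × ι', inferInstance, fun k z' => τ' (f z') (β z' (e k.1 (f z'))) k.2,
      fun k x => (LinearMap.proj k.1 ∘ₗ τ x).smulRight (e' k.2 x), fun k => ?_, fun k s hs => ?_, ?_⟩
    · obtain ⟨κ, _, d, σ, hd, hσ, hs⟩ := hβe k.1
      refine T.congr (T.sum Finset.univ fun j _ => T.mul (hd j)
        (hf.comp _ _ ((hτ'.smoothAt_iff _ _ hx').1 (hσ j) k.2))) ?_
      filter_upwards [hs] with z' hz'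
      rw [hz']
      simp
    · exact E'.smoothAt_smul ((hτ.smoothAt_iff _ _ hx).1 hs k.1) (he' k.2 _ hx')
    · filter_upwards [hf.continuous.continuousAt.eventually (hτ.isOpen.mem_nhds hx),
        hf.continuous.continuousAt.eventually (hτ'.isOpen.mem_nhds hx')] with z' hz hz'
      have key : β z' = ∑ k : ι × ι', τ' (f z') (β z' (e k.1 (f z'))) k.2 •
          (LinearMap.proj k.1 ∘ₗ τ (f z')).smulRight (e' k.2 (f z')) := by
        ext v
        conv_lhs => rw [hev _ hz v, map_sum]
        rw [Fintype.sum_prod_type]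
        simp only [LinearMap.sum_apply, LinearMap.smul_apply, LinearMap.smulRight_apply,
          LinearMap.comp_apply, LinearMap.proj_apply, map_smul]
        refine Finset.sum_congr rfl fun i _ => ?_
        conv_lhs => rw [hev' _ hz' (β z' (e i (f z'))), Finset.smul_sum]
        exact Finset.sum_congr rfl fun j _ => smul_comm _ _ _
      exact key

/-- Applying `id ⊗ β` to a smooth section of a tensor product. -/
lemma smoothAt_lTensor (L E E' : SmoothBundle S) (β : ∀ x, E.Fiber x →ₗ[ℂ] E'.Fiber x) {x : X}
    (hβ : ∀ s, E.SmoothAt s x → E'.SmoothAt (fun x' => β x' (s x')) x)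
    {t : ∀ x, L.Fiber x ⊗[ℂ] E.Fiber x} (ht : (tensor L E).SmoothAt t x) :
    (tensor L E').SmoothAt (fun x' => (β x').lTensor (L.Fiber x') (t x')) x := by
  obtain ⟨κ, _, a, b, ha, hb, h⟩ := ht
  refine ⟨κ, inferInstance, a, fun k x' => β x' (b k x'), ha, fun k => hβ _ (hb k), ?_⟩
  filter_upwards [h] with x' h'
  rw [h', map_sum]
  rfl

/-- Contracting a smooth section of `L ⊗ E` with a smooth family of linear forms on `L`. -/
lemma smoothAt_contract (L E : SmoothBundle S) (α : ∀ x, L.Fiber x →ₗ[ℂ] ℂ) {x : X}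
    (hα : ∀ s, L.SmoothAt s x → S.SmoothAt (fun x' => α x' (s x')) x)
    {t : ∀ x, L.Fiber x ⊗[ℂ] E.Fiber x} (ht : (tensor L E).SmoothAt t x) :
    E.SmoothAt (fun x' => TensorProduct.lid ℂ _ ((α x').rTensor (E.Fiber x') (t x'))) x := by
  obtain ⟨κ, _, a, b, ha, hb, h⟩ := ht
  refine E.smoothAt_congr (E.smoothAt_sum Finset.univ fun k _ =>
    E.smoothAt_smul (hα _ (ha k)) (hb k)) ?_
  filter_upwards [h] with x' h'
  rw [h', map_sum, map_sum]
  simp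

end SmoothBundle

namespace GerbeModule

variable {G : BundleGerbe p} (N P Q : GerbeModule G)

/-- The isomorphism `φ_(y₁, y₂) : Hom(E_{y₂}, E'_{y₂}) ≃ Hom(L ⊗ E_{y₂}, L ⊗ E'_{y₂})
≃ Hom(E_{y₁}, E'_{y₁})`, where the first map is the canonical one and the second one is
`γ ↦ ρ' ∘ γ ∘ ρ⁻¹`. -/
def homTransport (z : p.Fib2) :
    (N.bundle.Fiber (p.pr1 z) →ₗ[ℂ] P.bundle.Fiber (p.pr1 z)) ≃ₗ[ℂ]
      (N.bundle.Fiber (p.pr2 z) →ₗ[ℂ] P.bundle.Fiber (p.pr2 z)) :=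
  (lineHomEquiv (G.finrank_eq_one z)).trans (LinearEquiv.arrowCongr (N.ρ.map z) (P.ρ.map z))

/-- The isomorphism `φ_(y₁, y₂)`. -/
def homTr {y₁ y₂ : Y} (h : p.π y₁ = p.π y₂) :
    (N.bundle.Fiber y₂ →ₗ[ℂ] P.bundle.Fiber y₂) ≃ₗ[ℂ]
      (N.bundle.Fiber y₁ →ₗ[ℂ] P.bundle.Fiber y₁) :=
  N.homTransport P (mk2 h)

lemma homTr_act {y₁ y₂ : Y} (h : p.π y₁ = p.π y₂)
    (β : N.bundle.Fiber y₂ →ₗ[ℂ] P.bundle.Fiber y₂) (a : G.L.Fiber (mk2 h))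
    (v : N.bundle.Fiber y₂) :
    N.homTr P h β (N.act h (a ⊗ₜ v)) = P.act h (a ⊗ₜ β v) := by
  have : (N.ρ.map (mk2 h)).symm (N.act h (a ⊗ₜ v)) = a ⊗ₜ v :=
    (N.ρ.map (mk2 h)).symm_apply_apply _
  show P.ρ.map (mk2 h) (β.lTensor _ ((N.ρ.map (mk2 h)).symm (N.act h (a ⊗ₜ v)))) = _
  rw [this]
  rfl

variable {N P} in
lemma hom_ext_act {y₁ y₂ : Y} (h : p.π y₁ = p.π y₂) {W : Type u} [AddCommGroup W] [Module ℂ W]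
    {γ γ' : N.bundle.Fiber y₁ →ₗ[ℂ] W}
    (hγ : ∀ a v, γ (N.act h (a ⊗ₜ v)) = γ' (N.act h (a ⊗ₜ v))) : γ = γ' := by
  have : γ ∘ₗ (N.act h).toLinearMap = γ' ∘ₗ (N.act h).toLinearMap :=
    TensorProduct.ext' fun a v => hγ a v
  ext w
  obtain ⟨t, rfl⟩ := (N.act h).surjective w
  exact LinearMap.congr_fun this t

lemma homTr_trans {y₁ y₂ y₃ : Y} (h : p.π y₁ = p.π y₂) (h' : p.π y₂ = p.π y₃)
    (β : N.bundle.Fiber y₃ →ₗ[ℂ] P.bundle.Fiber y₃) :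
    N.homTr P (h.trans h') β = N.homTr P h (N.homTr P h' β) := by
  refine hom_ext_act h fun a w => ?_
  obtain ⟨t, rfl⟩ := (N.act h').surjective w
  induction t using TensorProduct.induction_on with
  | zero => simp
  | tmul b v => rw [homTr_act, homTr_act, N.act_act, homTr_act, P.act_act]
  | add x y hx hy => simp only [map_add, tmul_add, hx, hy]

lemma homTr_comp {y₁ y₂ : Y} (h : p.π y₁ = p.π y₂)
    (γ : P.bundle.Fiber y₂ →ₗ[ℂ] Q.bundle.Fiber y₂)
    (β : N.bundle.Fiber y₂ →ₗ[ℂ] P.bundle.Fiber y₂) :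
    N.homTr Q h (γ ∘ₗ β) = P.homTr Q h γ ∘ₗ N.homTr P h β :=
  hom_ext_act h fun a v => by simp only [LinearMap.comp_apply, homTr_act]

lemma homTr_id {y₁ y₂ : Y} (h : p.π y₁ = p.π y₂) :
    N.homTr N h LinearMap.id = LinearMap.id :=
  hom_ext_act h fun a v => by simp only [homTr_act, LinearMap.id_apply]

/-- The homomorphism bundle `Hom(E, E')` with its descent isomorphism, as an object of the descent
category. -/
@[reducible]
def homDatum : DescentDatum p where
  E := homBundle N.bundle P.bundle
  φ :=
    { map := N.homTransport P
      smooth := by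
        intro β z hβ
        have hβ' := (smoothAt_pullback_homBundle p.pr1_smooth N.bundle P.bundle β z).1 hβ
        refine (smoothAt_pullback_homBundle p.pr2_smooth N.bundle P.bundle _ z).2 fun s hs => ?_
        exact P.ρ.smooth _ z (smoothAt_lTensor G.L.toSmoothBundle (pullback p.pr1_smooth N.bundle)
          (pullback p.pr1_smooth P.bundle) β hβ' (N.ρ.smooth_symm s z hs))
      smooth_symm := by
        intro γ z hγ
        have hγ' := (smoothAt_pullback_homBundle p.pr2_smooth N.bundle P.bundle γ z).1 hγ
        refine (smoothAt_pullback_homBundle p.pr1_smooth N.bundle P.bundle _ z).2 fun s hs => ?_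
        obtain ⟨U, ι, hι, τ, hx, hτ⟩ := G.L.toSmoothBundle.locallyTrivial z
        have := Fintype.ofFinite ι
        obtain ⟨e, he, hev, hec⟩ := hτ.exists_frame
        obtain ⟨i⟩ : Nonempty ι := by
          by_contra hne
          rw [not_nonempty_iff] at hne
          have h0 : ∀ a : G.L.Fiber z, a = 0 := fun a => by rw [hev z hx a]; simp
          have h1 := G.finrank_eq_one z
          have : Subsingleton (G.L.Fiber z) := ⟨fun a b => by rw [h0 a, h0 b]⟩
          rw [Module.finrank_zero_of_subsingleton] at h1
          exact zero_ne_one h1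
        let β := fun z => (N.homTransport P z).symm (γ z)
        let γ' : ∀ z, N.bundle.Fiber (p.pr2 z) →ₗ[ℂ] P.bundle.Fiber (p.pr2 z) := γ
        let t : ∀ z, G.L.Fiber z ⊗[ℂ] P.bundle.Fiber (p.pr1 z) := fun z =>
          (P.ρ.map z).symm (γ' z (N.ρ.map z (e i z ⊗ₜ[ℂ] s z)))
        have ht : (tensor G.L.toSmoothBundle (pullback p.pr1_smooth P.bundle)).SmoothAt t z :=
          P.ρ.smooth_symm _ z (hγ' _ (N.ρ.smooth _ z
            ⟨Unit, inferInstance, fun _ => e i, fun _ => s, fun _ => he i z hx, fun _ => hs,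
              Eventually.of_forall fun z' => by simp⟩))
        have htβ : ∀ z, t z = (β z).lTensor (G.L.Fiber z) (e i z ⊗ₜ[ℂ] s z) := fun z => by
          have h1 : γ' z = N.homTransport P z (β z) := ((N.homTransport P z).apply_symm_apply _).symm
          have h2 : N.homTransport P z (β z) (N.ρ.map z (e i z ⊗ₜ[ℂ] s z)) = P.ρ.map z
              ((β z).lTensor (G.L.Fiber z) (e i z ⊗ₜ[ℂ] s z)) := by
            show P.ρ.map z ((β z).lTensor _ ((N.ρ.map z).symm (N.ρ.map z _))) = _
            rw [(N.ρ.map z).symm_apply_apply]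
          show (P.ρ.map z).symm (γ' z (N.ρ.map z (e i z ⊗ₜ[ℂ] s z))) = _
          rw [h1, h2]
          exact (P.ρ.map z).symm_apply_apply _
        refine (pullback p.pr1_smooth P.bundle).smoothAt_congr (smoothAt_contract
          G.L.toSmoothBundle (pullback p.pr1_smooth P.bundle)
          (fun z => LinearMap.proj i ∘ₗ τ z)
          (fun a ha => (hτ.smoothAt_iff a z hx).1 ha i) ht) ?_
        filter_upwards [hτ.isOpen.mem_nhds hx] with z' hz'
        have hei : τ z' (e i z') i = 1 := by
          classical
          have := congrFun (hec z' hz' (Pi.single i 1)) i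
          simpa [Pi.single_apply, ite_smul] using this
        rw [htβ z', LinearMap.lTensor_tmul, LinearMap.rTensor_tmul, TensorProduct.lid_tmul]
        simp only [LinearMap.comp_apply, LinearMap.proj_apply, hei, one_smul]
        rfl }
  cocycle := fun h h' β => N.homTr_trans P h h' β

/-- The vector bundle on `M` obtained from `Hom(E, E')` by descent. -/
abbrev descHom : SmoothBundle p.smoothM := (N.homDatum P).descend

end GerbeModule

end Submersion

/-- A smooth bundle of complex algebras: a smooth vector bundle whose fibres are algebras, with
smooth unit and smooth multiplication. -/
structure AlgebraBundle {X : Type u} [TopologicalSpace X] (S : SmoothFunctions X) where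
  Fiber : X → Type u
  [ring : ∀ x, Ring (Fiber x)]
  [algebra : ∀ x, Algebra ℂ (Fiber x)]
  SmoothAt : (∀ x, Fiber x) → X → Prop
  locallyTrivial : ∀ x₀ : X, ∃ (U : Set X) (ι : Type) (_ : Finite ι)
    (τ : ∀ x, Fiber x →ₗ[ℂ] (ι → ℂ)), x₀ ∈ U ∧ IsTrivialization S SmoothAt U τ
  one_smooth : ∀ x, SmoothAt (fun _ => 1) x
  mul_smooth : ∀ s t x, SmoothAt s x → SmoothAt t x → SmoothAt (fun x' => s x' * t x') x

namespace AlgebraBundle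

attribute [instance] AlgebraBundle.ring AlgebraBundle.algebra

variable {X : Type u} [TopologicalSpace X] {S : SmoothFunctions X} (A : AlgebraBundle S)

/-- The underlying vector bundle. -/
@[reducible]
def toSmoothBundle : SmoothBundle S where
  Fiber := A.Fiber
  SmoothAt := A.SmoothAt
  locallyTrivial := A.locallyTrivial

/-- The algebra of global sections of an algebra bundle. -/
def sectionAlgebra : Subalgebra ℂ (∀ x, A.Fiber x) where
  carrier := {s | ∀ x, A.SmoothAt s x}
  mul_mem' h h' x := A.mul_smooth _ _ x (h x) (h' x)
  add_mem' h h' x := A.toSmoothBundle.smoothAt_add (h x) (h' x)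
  algebraMap_mem' c x := by
    have := A.toSmoothBundle.smoothAt_smul (S.const c x) (A.one_smooth x)
    simp only [Algebra.algebraMap_eq_smul_one]
    exact this

/-- The algebra of sections is an Azumaya algebra over the base: the fibres are Azumaya algebras
over `ℂ`. -/
def IsAzumayaBundle : Prop := ∀ x, IsAzumaya ℂ (A.Fiber x)

end AlgebraBundle

section Functor

open SmoothBundle SurjectiveSubmersion

variable {EY EM : Type*} [NormedAddCommGroup EY] [NormedSpace ℝ EY] [NormedAddCommGroup EM]
  [NormedSpace ℝ EM] {Y M : Type u} [TopologicalSpace Y] [ChartedSpace EY Y]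
  [TopologicalSpace M] [ChartedSpace EM M] {p : SurjectiveSubmersion EY EM Y M}
  {G : BundleGerbe p}

namespace GerbeModule

variable (K : GerbeModule G)

/-- The morphism `β ↦ f ∘ β` of the descent category induced by a morphism `f` of gerbe modules. -/
def homDatumMap {N P : GerbeModule G} (f : N ⟶ P) :
    DescentDatum.Hom (K.homDatum N) (K.homDatum P) where
  f :=
    { map := fun y => LinearMap.compRight ℂ (fiberMap f y)
      smooth := fun β y hβ s hs => f.2.1 _ y (hβ s hs) }
  comm := by
    intro y₁ y₂ h β
    refine hom_ext_act (N := K) h fun a v => ?_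
    have h1 := K.homTr_act N h β a v
    have h2 := K.homTr_act P h (fiberMap f y₂ ∘ₗ β) a v
    exact ((congrArg (fiberMap f y₁) h1).trans (f.2.2 h a (β v))).trans h2.symm

/-- Composition `Hom(E, E')_m × Hom(E, E)_m → Hom(E, E')_m` on the descended bundles. -/
def descComp (N : GerbeModule G) {m : M} (s : (K.descHom N).Fiber m)
    (a : (K.descHom K).Fiber m) : (K.descHom N).Fiber m :=
  ⟨fun y => (s.1 y : K.bundle.Fiber y →ₗ[ℂ] N.bundle.Fiber y) ∘ₗ
      (a.1 y : K.bundle.Fiber y →ₗ[ℂ] K.bundle.Fiber y), fun y₁ y₂ => by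
    have h := y₁.2.trans y₂.2.symm
    have h1 := K.homTr_comp K N h (s.1 y₂) (a.1 y₂)
    have h2 : K.homTr N h (s.1 y₂) = s.1 y₁ := s.2 y₁ y₂
    have h3 : K.homTr K h (a.1 y₂) = a.1 y₁ := a.2 y₁ y₂
    rw [h2, h3] at h1
    exact h1⟩

/-- The unit of `Hom(E, E)_m`. -/
def descOne (m : M) : (K.descHom K).Fiber m :=
  ⟨fun y => (LinearMap.id : K.bundle.Fiber y →ₗ[ℂ] K.bundle.Fiber y),
    fun y₁ y₂ => K.homTr_id (y₁.2.trans y₂.2.symm)⟩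

lemma desc_ext {N : GerbeModule G} {m : M} {s t : (K.descHom N).Fiber m}
    (h : ∀ (y : {y : Y // p.π y = m}) (v : K.bundle.Fiber y.1), (s.1 y : K.bundle.Fiber y →ₗ[ℂ] N.bundle.Fiber y) v =
      (t.1 y : K.bundle.Fiber y →ₗ[ℂ] N.bundle.Fiber y) v) : s = t :=
  Subtype.ext (funext fun y => LinearMap.ext (h y))

instance descRing (m : M) : Ring ((K.descHom K).Fiber m) :=
  { (K.descHom K).addCommGroup m with
    mul := K.descComp K
    one := K.descOne m
    mul_assoc := fun _ _ _ => rfl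
    one_mul := fun _ => rfl
    mul_one := fun _ => rfl
    left_distrib := fun a _ _ => K.desc_ext fun y _ =>
      map_add (a.1 y : K.bundle.Fiber y →ₗ[ℂ] K.bundle.Fiber y) _ _
    right_distrib := fun _ _ _ => rfl
    zero_mul := fun _ => rfl
    mul_zero := fun a => K.desc_ext fun y _ =>
      map_zero (a.1 y : K.bundle.Fiber y →ₗ[ℂ] K.bundle.Fiber y) }

instance descAlgebra (m : M) : Algebra ℂ ((K.descHom K).Fiber m) :=
  letI : Module ℂ ((K.descHom K).Fiber m) := (K.descHom K).module m
  Algebra.ofModule (fun _ _ _ => rfl) (fun c a _ => K.desc_ext fun y _ =>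
    map_smul (a.1 y : K.bundle.Fiber y →ₗ[ℂ] K.bundle.Fiber y) c _)

/-- The bundle of algebras on `M` obtained from `End(E)` by descent. -/
def endBundle : AlgebraBundle p.smoothM where
  Fiber := (K.descHom K).Fiber
  SmoothAt := (K.descHom K).SmoothAt
  locallyTrivial := (K.descHom K).locallyTrivial
  one_smooth _ _ _ := fun _ hs => hs
  mul_smooth _ _ _ hs ht y hy := fun v hv => hs y hy _ (ht y hy v hv)

/-- The algebra `𝒜^𝓜 = Γ(M, D(End(E)))`. -/
abbrev azumayaAlgebra : Type u := K.endBundle.sectionAlgebra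

/-- The space `𝒜^𝓜𝓝 = Γ(M, D(Hom(E, E')))`. -/
abbrev azumayaModule (N : GerbeModule G) : Type u := (K.descHom N).sections

/-- The right action of `𝒜^𝓜` on `𝒜^𝓜𝓝`, by composition. -/
instance (N : GerbeModule G) : Module (K.azumayaAlgebra)ᵐᵒᵖ (K.azumayaModule N) where
  smul a s := ⟨fun m => K.descComp N (s.1 m) (a.unop.1 m), fun m y hy v hv =>
    s.2 m y hy _ (a.unop.2 m y hy v hv)⟩
  one_smul _ := rfl
  mul_smul _ _ _ := rfl
  smul_zero _ := rfl
  smul_add _ _ _ := rfl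
  add_smul _ _ s := Subtype.ext (funext fun m => K.desc_ext fun y _ =>
    map_add (((s.1 m).1 y) : K.bundle.Fiber y →ₗ[ℂ] N.bundle.Fiber y) _ _)
  zero_smul s := Subtype.ext (funext fun m => K.desc_ext fun y _ =>
    map_zero (((s.1 m).1 y) : K.bundle.Fiber y →ₗ[ℂ] N.bundle.Fiber y))

/-- The homomorphism of right `𝒜^𝓜`-modules `𝒜^𝓜𝓝 → 𝒜^𝓜𝓟` induced by a morphism `𝓝 → 𝓟`. -/
def azumayaMap {N P : GerbeModule G} (f : N ⟶ P) :
    K.azumayaModule N →ₗ[(K.azumayaAlgebra)ᵐᵒᵖ] K.azumayaModule P where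
  toFun s := ⟨fun m => (DescentDatum.descendMap (K.homDatumMap f)).map m (s.1 m),
    fun m => (DescentDatum.descendMap (K.homDatumMap f)).smooth _ m (s.2 m)⟩
  map_add' _ _ := Subtype.ext (funext fun _ => map_add _ _ _)
  map_smul' _ _ := rfl

/-- The functor `𝓕^𝓜 : 𝓝 ↦ Γ(M, D(Hom(E, E')))` from gerbe modules to right `𝒜^𝓜`-modules. -/
def sectionFunctor : GerbeModule G ⥤ ModuleCat.{u} (K.azumayaAlgebra)ᵐᵒᵖ where
  obj N := ModuleCat.of _ (K.azumayaModule N)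
  map f := ModuleCat.ofHom (K.azumayaMap f)
  map_id _ := rfl
  map_comp _ _ := rfl

end GerbeModule

end Functor

/-- Finitely generated projective right modules over a ring `A`. -/
def pfmod (A : Type u) [Ring A] : ObjectProperty (ModuleCat.{u} Aᵐᵒᵖ) := fun P =>
  Module.Finite Aᵐᵒᵖ P ∧ Module.Projective Aᵐᵒᵖ P

end GerbeMod

end

noncomputable section

namespace GerbeMod

open SmoothBundle SurjectiveSubmersion

section

variable {EY EM : Type*} [NormedAddCommGroup EY] [NormedSpace ℝ EY] [NormedAddCommGroup EM]
  [NormedSpace ℝ EM] {Y M : Type u} [TopologicalSpace Y] [ChartedSpace EY Y]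
  [TopologicalSpace M] [ChartedSpace EM M] {p : SurjectiveSubmersion EY EM Y M}
  {G : BundleGerbe p}

namespace GerbeModule

variable (K : GerbeModule G)

/-! ### Sections of the descended homomorphism bundle are morphisms of gerbe modules -/

/-! A family of maps `β_y : E_y → E'_y` is invariant under the descent transport `β ↦ ρ' ∘ (id ⊗ β)
∘ ρ⁻¹` exactly when it commutes with the gerbe actions. So a global section of the descended bundle
is a morphism of gerbe modules (`sectionEquiv`): the algebra is `End(K)`, its right action on
`Hom(K, N)` is precomposition, and the functor is `Hom(K, -)`.

The equivalence is then a formal Morita argument (`sectionFunctor_properties`) with three inputs: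
every `N` is a summand of a finite power of `K`, finite powers of `K` exist, and idempotents split.
A decomposition `∑ k, γ k ≫ β k = 𝟙 N` makes `Hom(K, N)` a retract of a finite free module. It also
shows that every linear map out of `Hom(K, N)` is composition with a unique morphism. A finitely
generated projective module is the image of an idempotent of `Hom(K, B)`, with `B` a power of `K`.
That idempotent comes from `B`, and splitting it there yields the required gerbe module.

Powers and images of idempotents are both instances of `BundleSummand`, which carries the action and
the metric over to the summand. That the image of an idempotent is a vector bundle
(`exists_isTrivialization_range`) follows by conjugating nearby idempotent matrices to a constant
one.

For generation (`IsNontrivial.generates`), the identity of `N` is written near a point as a sum of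
rank-one maps through one nonzero frame vector of `K`. Squared cutoffs of these local decompositions
add up, by compactness, to a positive function, by which one divides. This needs every fibre of `K`
to be nonzero, which follows from the local constancy of the rank on `M`. The same fact makes the
fibres of the endomorphism bundle matrix algebras of positive size, hence Azumaya. -/

variable {K} in
lemma homTr_fiberMap {N : GerbeModule G} (f : K ⟶ N) {y₁ y₂ : Y} (h : p.π y₁ = p.π y₂) :
    K.homTr N h (fiberMap f y₂) = fiberMap f y₁ :=
  hom_ext_act h fun a v => (K.homTr_act N h _ a v).trans (f.2.2 h a v).symm

/-- A family of linear maps that is compatible with descent commutes with the gerbe action. -/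
lemma homTr_eq_iff {N : GerbeModule G} {y₁ y₂ : Y} (h : p.π y₁ = p.π y₂)
    (β₂ : K.bundle.Fiber y₂ →ₗ[ℂ] N.bundle.Fiber y₂)
    (β₁ : K.bundle.Fiber y₁ →ₗ[ℂ] N.bundle.Fiber y₁) :
    K.homTr N h β₂ = β₁ ↔ ∀ a v, β₁ (K.act h (a ⊗ₜ v)) = N.act h (a ⊗ₜ β₂ v) := by
  constructor
  · rintro rfl a v
    exact K.homTr_act N h β₂ a v
  · exact fun H => hom_ext_act h fun a v => (K.homTr_act N h _ a v).trans (H a v).symm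

/-- The section of the descended bundle given by a morphism of gerbe modules. -/
def sectionOfHom {N : GerbeModule G} (f : K ⟶ N) : K.azumayaModule N :=
  ⟨fun _ => ⟨fun y => fiberMap f y.1, fun _ _ => homTr_fiberMap f _⟩,
    fun _ y _ s hs => f.2.1 s y hs⟩

variable {K} in
/-- The morphism of gerbe modules given by a section of the descended bundle. -/
def homOfSection {N : GerbeModule G} (s : K.azumayaModule N) : K ⟶ N :=
  ⟨fun y => (K.homDatum N).lift s.1 y, fun t y ht => s.2 (p.π y) y rfl t ht, fun h =>
    (K.homTr_eq_iff h _ _).1 ((K.homDatum N).tr_lift s.1 h)⟩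

lemma homOfSection_sectionOfHom {N : GerbeModule G} (f : K ⟶ N) :
    homOfSection (K.sectionOfHom f) = f := rfl

/-- Unlike the other composite, this one is not definitional: a component at `y` over `m` has to be
compared with the lift, which is formed over `p.π y`. -/
lemma sectionOfHom_homOfSection {N : GerbeModule G} (s : K.azumayaModule N) :
    K.sectionOfHom (homOfSection s) = s :=
  Subtype.ext (funext fun _ => Subtype.ext (funext fun y =>
    ((K.homDatum N).lift_eq s.1 y.2).symm))

/-- Sections of the descended bundle `Hom(E, E')` are morphisms of gerbe modules. -/
def sectionEquiv (N : GerbeModule G) : K.azumayaModule N ≃ₗ[ℂ] (K ⟶ N) where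
  toFun := homOfSection
  invFun := K.sectionOfHom
  map_add' _ _ := rfl
  map_smul' _ _ := rfl
  left_inv := K.sectionOfHom_homOfSection
  right_inv := K.homOfSection_sectionOfHom

/-- The element of `𝒜^𝓜` given by an endomorphism. -/
def algebraOfHom (f : K ⟶ K) : K.azumayaAlgebra := ⟨(K.sectionOfHom f).1, (K.sectionOfHom f).2⟩

variable {K} in
/-- The endomorphism given by an element of `𝒜^𝓜`. -/
def homOfAlgebra (a : K.azumayaAlgebra) : K ⟶ K := homOfSection (N := K) ⟨a.1, a.2⟩

lemma algebraOfHom_homOfAlgebra (a : K.azumayaAlgebra) :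
    K.algebraOfHom (homOfAlgebra a) = a :=
  Subtype.ext (congrArg Subtype.val (K.sectionOfHom_homOfSection (N := K) ⟨a.1, a.2⟩))

lemma algebraOfHom_id : K.algebraOfHom (𝟙 K) = 1 := rfl

instance (N : GerbeModule G) : SMul K.azumayaAlgebraᵐᵒᵖ (K.azumayaModule N) :=
  (inferInstance : Module K.azumayaAlgebraᵐᵒᵖ (K.azumayaModule N)).toSMul

/-- With `azumayaMap_sectionOfHom`, this identifies the section functor with `Hom(K, -)`; the
arguments below are carried out with morphisms. -/
lemma smul_sectionOfHom {N : GerbeModule G} (f : K ⟶ K) (g : K ⟶ N) :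
    MulOpposite.op (K.algebraOfHom f) • K.sectionOfHom g = K.sectionOfHom (f ≫ g) := rfl

lemma azumayaMap_sectionOfHom {N P : GerbeModule G} (g : K ⟶ N) (f : N ⟶ P) :
    K.azumayaMap f (K.sectionOfHom g) = K.sectionOfHom (g ≫ f) := rfl

lemma sectionOfHom_sum {N : GerbeModule G} {κ : Type*} (F : Finset κ) (f : κ → (K ⟶ N)) :
    K.sectionOfHom (∑ k ∈ F, f k) = ∑ k ∈ F, K.sectionOfHom (f k) :=
  map_sum (K.sectionEquiv N).symm f F

lemma sectionOfHom_injective {N : GerbeModule G} :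
    Function.Injective (K.sectionOfHom (N := N)) := (K.sectionEquiv N).symm.injective

lemma sectionOfHom_surjective {N : GerbeModule G} :
    Function.Surjective (K.sectionOfHom (N := N)) := (K.sectionEquiv N).symm.surjective

lemma algebraOfHom_surjective : Function.Surjective K.algebraOfHom :=
  fun a => ⟨_, K.algebraOfHom_homOfAlgebra a⟩

end GerbeModule

end

end GerbeMod

namespace GerbeMod

open SmoothBundle SurjectiveSubmersion

section

variable {EY EM : Type*} [NormedAddCommGroup EY] [NormedSpace ℝ EY] [NormedAddCommGroup EM]
  [NormedSpace ℝ EM] {Y M : Type u} [TopologicalSpace Y] [ChartedSpace EY Y]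
  [TopologicalSpace M] [ChartedSpace EM M] {p : SurjectiveSubmersion EY EM Y M}
  {G : BundleGerbe p}

namespace GerbeModule

/-! ### The section functor of a generator -/

/-- `K` generates `N`: the module `N` is a direct summand of a finite power of `K`. -/
def Generates (K N : GerbeModule G) : Prop :=
  ∃ (κ : Type) (_ : Fintype κ) (γ : κ → (N ⟶ K)) (β : κ → (K ⟶ N)), ∑ k, γ k ≫ β k = 𝟙 N

/-- `B` is a direct sum of copies of `K`. -/
def IsPower (K B : GerbeModule G) (κ : Type) [Fintype κ] [DecidableEq κ] : Prop :=
  ∃ (i : κ → (K ⟶ B)) (q : κ → (B ⟶ K)),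
    (∀ k l, i k ≫ q l = if k = l then 𝟙 K else 0) ∧ ∑ k, q k ≫ i k = 𝟙 B

variable {K : GerbeModule G}

section Generates

variable {N : GerbeModule G} {κ : Type} [Fintype κ] {γ : κ → (N ⟶ K)} {β : κ → (K ⟶ N)}

/-- Inserting the decomposed identity of `N` after `f` leaves the endomorphisms `f ≫ γ k` of `K` as
coefficients of the generators `β k`. -/
lemma section_eq_sum (h : ∑ k, γ k ≫ β k = 𝟙 N) (f : K ⟶ N) :
    K.sectionOfHom f =
      ∑ k, MulOpposite.op (K.algebraOfHom (f ≫ γ k)) • K.sectionOfHom (β k) := by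
  conv_lhs => rw [← Category.comp_id f, ← h, Preadditive.comp_sum, sectionOfHom_sum]
  exact Finset.sum_congr rfl fun k _ => by rw [smul_sectionOfHom, Category.assoc]

/-- The coordinates of sections with respect to finitely many generators. -/
def coordinates (γ : κ → (N ⟶ K)) :
    K.azumayaModule N →ₗ[K.azumayaAlgebraᵐᵒᵖ] (κ → K.azumayaAlgebraᵐᵒᵖ) where
  toFun s k := MulOpposite.op (K.algebraOfHom (homOfSection s ≫ γ k))
  map_add' s t := funext fun k => by
    show MulOpposite.op (K.algebraOfHom ((homOfSection s + homOfSection t) ≫ γ k)) = _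
    rw [Preadditive.add_comp]
    rfl
  map_smul' a s := by
    obtain ⟨a, rfl⟩ := MulOpposite.op_surjective a
    obtain ⟨f, rfl⟩ := K.algebraOfHom_surjective a
    rfl

/-- By `section_eq_sum`, taking coordinates is a linear section of the map from a finite free module
given by the `β k`, so the module is a retract of a finite free one. -/
lemma Generates.pfmod (h : K.Generates N) : pfmod K.azumayaAlgebra (K.sectionFunctor.obj N) := by
  obtain ⟨κ, _, γ, β, h⟩ := h
  have hsplit : (Fintype.linearCombination K.azumayaAlgebraᵐᵒᵖ fun k => K.sectionOfHom (β k)) ∘ₗ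
      coordinates γ = LinearMap.id := by
    ext1 s
    obtain ⟨f, rfl⟩ := K.sectionOfHom_surjective s
    exact (section_eq_sum h f).symm
  refine ⟨?_, ?_⟩
  · exact Module.Finite.of_surjective
      (Fintype.linearCombination K.azumayaAlgebraᵐᵒᵖ fun k => K.sectionOfHom (β k))
      fun s => ⟨_, LinearMap.congr_fun hsplit s⟩
  · exact Module.Projective.of_split (coordinates γ) _ hsplit

/-- Fullness. The `β k` generate, so `φ` is known from the morphisms `φ(β k) : K ⟶ P`; precomposing
these with `γ k` and summing reassembles a morphism out of `N`. -/
lemma Generates.exists_azumayaMap_eq (h : K.Generates N) {P : GerbeModule G}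
    (φ : K.azumayaModule N →ₗ[K.azumayaAlgebraᵐᵒᵖ] K.azumayaModule P) :
    ∃ f : N ⟶ P, K.azumayaMap f = φ := by
  obtain ⟨κ, _, γ, β, h⟩ := h
  refine ⟨∑ k, γ k ≫ homOfSection (φ (K.sectionOfHom (β k))), ?_⟩
  ext1 s
  obtain ⟨f, rfl⟩ := K.sectionOfHom_surjective s
  rw [azumayaMap_sectionOfHom, section_eq_sum h f, map_sum, Preadditive.comp_sum,
    sectionOfHom_sum]
  refine Finset.sum_congr rfl fun k _ => ?_
  rw [map_smul, ← Category.assoc, ← smul_sectionOfHom, sectionOfHom_homOfSection]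

/-- Faithfulness. Evaluating on the generators shows that `f` and `g` agree after each `β k`, and
the identity of `N` factors through these. -/
lemma Generates.azumayaMap_injective (h : K.Generates N) {P : GerbeModule G} {f g : N ⟶ P}
    (hfg : K.azumayaMap f = K.azumayaMap g) : f = g := by
  obtain ⟨κ, _, γ, β, h⟩ := h
  have hβ : ∀ k, β k ≫ f = β k ≫ g := fun k => K.sectionOfHom_injective
    (LinearMap.congr_fun hfg (K.sectionOfHom (β k)))
  rw [← Category.id_comp f, ← Category.id_comp g, ← h, Preadditive.sum_comp,
    Preadditive.sum_comp]
  exact Finset.sum_congr rfl fun k _ => by rw [Category.assoc, hβ, Category.assoc]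

end Generates

/-- Every family of elements of a right `𝒜^𝓜`-module is the image of the standard basis of
`𝒜^𝓜𝓑`, where `𝓑` is a power of `𝓜`. -/
lemma IsPower.exists_linearMap {B : GerbeModule G} {κ : Type} [Fintype κ] [DecidableEq κ]
    {P : Type*} [AddCommGroup P] [Module K.azumayaAlgebraᵐᵒᵖ P] (h : K.IsPower B κ) (x : κ → P) :
    ∃ (φ : K.azumayaModule B →ₗ[K.azumayaAlgebraᵐᵒᵖ] P) (s : κ → K.azumayaModule B),
      ∀ k, φ (s k) = x k := by
  obtain ⟨i, q, h, -⟩ := h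
  refine ⟨(Fintype.linearCombination K.azumayaAlgebraᵐᵒᵖ x) ∘ₗ coordinates q,
    fun k => K.sectionOfHom (i k), fun k => ?_⟩
  -- The relations between injections and projections say that the injections have the standard
  -- basis vectors as coordinates.
  have hq : coordinates q (K.sectionOfHom (i k)) = Pi.single k 1 := by
    ext1 l
    show MulOpposite.op (K.algebraOfHom (i k ≫ q l)) = _
    rw [h]
    by_cases hkl : k = l
    · subst hkl
      rw [if_pos rfl, Pi.single_eq_same, algebraOfHom_id]
      rfl
    · rw [if_neg hkl, Pi.single_eq_of_ne (Ne.symm hkl)]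
      rfl
  rw [LinearMap.comp_apply, hq, Fintype.linearCombination_apply_single, one_smul]

/-- On modules over the algebra, a complex number acts through the algebra, that is by
precomposition with a scalar endomorphism of `K`. On morphisms of gerbe modules it acts on values;
the two agree because the components of a section are linear. -/
lemma azumayaMap_smul {N P : GerbeModule G} (f : N ⟶ P) (c : ℂ) (s : K.azumayaModule N) :
    K.azumayaMap (c • f) s = algebraMap ℂ K.azumayaAlgebraᵐᵒᵖ c • K.azumayaMap f s := by
  refine Subtype.ext (funext fun m => K.desc_ext fun y v => ?_)
  exact ((fiberMap f y.1 ∘ₗ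
    ((s.1 m).1 y : K.bundle.Fiber y →ₗ[ℂ] N.bundle.Fiber y)).map_smul c v).symm

/-- Every finitely generated projective module is isomorphic to a module of sections. -/
lemma exists_iso_of_finite_projective [IsIdempotentComplete (GerbeModule G)]
    (hgen : ∀ N, K.Generates N) (hpow : ∀ n : ℕ, ∃ B, K.IsPower B (Fin n))
    (P : ModuleCat.{u} K.azumayaAlgebraᵐᵒᵖ) (hfin : Module.Finite K.azumayaAlgebraᵐᵒᵖ P)
    (hproj : Module.Projective K.azumayaAlgebraᵐᵒᵖ P) :
    ∃ N, Nonempty (K.sectionFunctor.obj N ≅ P) := by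
  obtain ⟨n, x, hx⟩ := Module.Finite.exists_fin (R := K.azumayaAlgebraᵐᵒᵖ) (M := P)
  obtain ⟨B, hB⟩ := hpow n
  obtain ⟨φ, s, hφ⟩ := hB.exists_linearMap x
  have hsurj : LinearMap.range φ = ⊤ := by
    rw [eq_top_iff, ← hx, Submodule.span_le]
    rintro _ ⟨k, rfl⟩
    exact ⟨s k, hφ k⟩
  -- Projectivity splits `φ`, so `P` is the image of the idempotent `ψ ∘ φ`, which fullness realises
  -- by an endomorphism `f` of `B`.
  obtain ⟨ψ, hψ⟩ := Module.projective_lifting_property φ LinearMap.id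
    (LinearMap.range_eq_top.1 hsurj)
  obtain ⟨f, hf⟩ := (hgen B).exists_azumayaMap_eq (ψ ∘ₗ φ)
  have hφψ : ∀ v, φ (ψ v) = v := LinearMap.congr_fun hψ
  -- Faithfulness transfers idempotency from `ψ ∘ φ` to `f`.
  have hff : f ≫ f = f := (hgen B).azumayaMap_injective (by
    ext1 s
    show K.azumayaMap f (K.azumayaMap f s) = _
    simp only [hf, LinearMap.comp_apply, hφψ])
  obtain ⟨R, i, e, hie, hei⟩ := IsIdempotentComplete.idempotents_split B f hff
  have h1 : ∀ s, K.azumayaMap e (K.azumayaMap i s) = s := fun s => by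
    show K.azumayaMap (i ≫ e) s = s
    rw [hie]
    rfl
  have h2 : ∀ s, K.azumayaMap i (K.azumayaMap e s) = ψ (φ s) := fun s => by
    show K.azumayaMap (e ≫ i) s = _
    rw [hei, hf]
    rfl
  -- The sections of `R` and the module `P` split the same idempotent, hence are isomorphic by going
  -- through `B`.
  refine ⟨R, ⟨LinearEquiv.toModuleIso (LinearEquiv.ofLinearMap (φ ∘ₗ K.azumayaMap i)
    (K.azumayaMap e ∘ₗ ψ) (LinearMap.ext fun v => ?_) (LinearMap.ext fun s => ?_))⟩⟩
  · show φ (K.azumayaMap i (K.azumayaMap e (ψ v))) = v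
    rw [h2, hφψ, hφψ]
  · show K.azumayaMap e (ψ (φ (K.azumayaMap i s))) = s
    rw [← h2, h1, h1]

/-- The section functor of a generator is an equivalence, provided that powers of the generator
exist and idempotents split. -/
lemma sectionFunctor_properties [IsIdempotentComplete (GerbeModule G)]
    (hgen : ∀ N, K.Generates N)
    (hpow : ∀ n : ℕ, ∃ B, K.IsPower B (Fin n)) :
    ∃ h : ∀ N : GerbeModule G, pfmod K.azumayaAlgebra (K.sectionFunctor.obj N),
      ((pfmod K.azumayaAlgebra).lift K.sectionFunctor h).Additive ∧
      ((pfmod K.azumayaAlgebra).lift K.sectionFunctor h).Linear ℂ ∧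
      ((pfmod K.azumayaAlgebra).lift K.sectionFunctor h).Full ∧
      ((pfmod K.azumayaAlgebra).lift K.sectionFunctor h).Faithful ∧
      ((pfmod K.azumayaAlgebra).lift K.sectionFunctor h).EssSurj ∧
      ((pfmod K.azumayaAlgebra).lift K.sectionFunctor h).IsEquivalence := by
  have : K.sectionFunctor.Full := ⟨fun φ => by
    obtain ⟨f, hf⟩ := (hgen _).exists_azumayaMap_eq φ.hom
    exact ⟨f, ModuleCat.hom_ext hf⟩⟩
  have : K.sectionFunctor.Faithful := ⟨fun h =>
    (hgen _).azumayaMap_injective (congrArg ModuleCat.Hom.hom h)⟩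
  have : ((pfmod K.azumayaAlgebra).lift K.sectionFunctor
      fun N => (hgen N).pfmod).EssSurj := ⟨fun P => by
    obtain ⟨N, ⟨e⟩⟩ := exists_iso_of_finite_projective hgen hpow P.obj P.property.1 P.property.2
    exact ⟨N, ⟨(pfmod K.azumayaAlgebra).isoMk e⟩⟩⟩
  refine ⟨fun N => (hgen N).pfmod, ⟨fun {_ _ _ _} => rfl⟩, ⟨fun {_ _} f c => ?_⟩, inferInstance,
    inferInstance, inferInstance, ⟨inferInstance, inferInstance, inferInstance⟩⟩
  apply ObjectProperty.hom_ext
  refine ModuleCat.hom_ext (LinearMap.ext fun s => ?_)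
  exact azumayaMap_smul f c s

end GerbeModule

end

end GerbeMod

namespace GerbeMod

open SmoothBundle SurjectiveSubmersion

/-! ### Pullbacks of bundle morphisms and finite direct sums of vector bundles. -/

namespace SmoothBundle

variable {X : Type u} [TopologicalSpace X] {S : SmoothFunctions X}

/-- The pullback of a morphism of vector bundles is smooth. -/
lemma Hom.smoothAt_pullback {Z : Type u} [TopologicalSpace Z] {T : SmoothFunctions Z} {f : Z → X}
    (hf : SmoothFunctions.IsSmoothMap T S f) {E E' : SmoothBundle S} (F : Hom E E')
    {t : ∀ z, E.Fiber (f z)} {z : Z} (ht : (pullback hf E).SmoothAt t z) :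
    (pullback hf E').SmoothAt (fun z' => F.map (f z') (t z')) z := by
  obtain ⟨κ, _, c, σ, hc, hσ, h⟩ := ht
  refine ⟨κ, inferInstance, c, fun k x => F.map x (σ k x), hc, fun k => F.smooth _ _ (hσ k), ?_⟩
  filter_upwards [h] with z' hz'
  rw [hz', map_sum]
  simp only [map_smul]

/-- The direct sum of finitely many copies of a vector bundle. -/
@[reducible]
def power (E : SmoothBundle S) (κ : Type) [Finite κ] : SmoothBundle S where
  Fiber x := κ → E.Fiber x
  SmoothAt s x := ∀ k, E.SmoothAt (fun x' => s x' k) x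
  locallyTrivial x₀ := by
    obtain ⟨U, ι, hι, τ, hx, hτ⟩ := E.locallyTrivial x₀
    refine ⟨U, κ × ι, inferInstance, fun x => LinearMap.pi fun k =>
      LinearMap.proj k.2 ∘ₗ τ x ∘ₗ LinearMap.proj k.1, hx, hτ.isOpen, fun x hx => ⟨?_, ?_⟩, ?_⟩
    · intro v w hvw
      funext k
      refine (hτ.bijective x hx).1 (funext fun i => ?_)
      exact congrFun hvw (k, i)
    · intro c
      choose v hv using fun k => (hτ.bijective x hx).2 fun i => c (k, i)
      refine ⟨v, funext fun k => ?_⟩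
      exact congrFun (hv k.1) k.2
    · intro s x hx
      simp only [hτ.smoothAt_iff _ x hx, Prod.forall]
      rfl

end SmoothBundle

section

variable {EY EM : Type*} [NormedAddCommGroup EY] [NormedSpace ℝ EY] [NormedAddCommGroup EM]
  [NormedSpace ℝ EM] {Y M : Type u} [TopologicalSpace Y] [ChartedSpace EY Y]
  [TopologicalSpace M] [ChartedSpace EM M] {p : SurjectiveSubmersion EY EM Y M}
  {G : BundleGerbe p}

/-! ### Vector bundle summands of powers of a gerbe module -/

/-- A vector bundle `F` that is a direct summand of `κ` copies of the vector bundle of a gerbe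
module `N`, such that the corresponding projection is a morphism of gerbe modules. -/
structure BundleSummand (N : GerbeModule G) (κ : Type) [Fintype κ] where
  F : SmoothBundle p.smoothY
  incl : κ → Hom F N.bundle
  proj : κ → Hom N.bundle F
  sum_proj_incl : ∀ y (w : F.Fiber y), ∑ k, (proj k).map y ((incl k).map y w) = w
  incl_proj_act : ∀ (k l : κ) (z : p.Fib2) (a : G.L.Fiber z) (v : N.bundle.Fiber (p.pr1 z)),
    (incl k).map _ ((proj l).map _ (N.ρ.map z (a ⊗ₜ v))) =
      N.ρ.map z (a ⊗ₜ (incl k).map _ ((proj l).map _ v))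

namespace BundleSummand

variable {N : GerbeModule G} {κ : Type} [Fintype κ] (D : BundleSummand N κ)

/-- The maps `incl k` are jointly injective because they have a joint left inverse. Identities in
the summand can therefore be checked in `N`. -/
lemma ext_incl {y : Y} {v w : D.F.Fiber y} (h : ∀ k, (D.incl k).map y v = (D.incl k).map y w) :
    v = w := by
  rw [← D.sum_proj_incl y v, ← D.sum_proj_incl y w]
  exact Finset.sum_congr rfl fun k _ => by rw [h]

/-- The restricted hermitian metric. -/
def hermitian : HermitianBundle p.smoothY where
  toSmoothBundle := D.F
  metric y :=
    { inner := fun v w => ∑ k, (N.E.metric y).inner ((D.incl k).map y v) ((D.incl k).map y w)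
      conj_inner_symm := fun v w => by
        rw [map_sum]
        exact Finset.sum_congr rfl fun k _ => (N.E.metric y).conj_inner_symm _ _
      re_inner_nonneg := fun v => by
        rw [map_sum]
        exact Finset.sum_nonneg fun k _ => (N.E.metric y).re_inner_nonneg _
      add_left := fun v w x => by
        rw [← Finset.sum_add_distrib]
        exact Finset.sum_congr rfl fun k _ => by rw [map_add, (N.E.metric y).add_left]
      smul_left := fun v w c => by
        rw [Finset.mul_sum]
        exact Finset.sum_congr rfl fun k _ => by rw [map_smul, (N.E.metric y).smul_left]
      definite := fun v hv => by
        refine D.ext_incl fun k => ?_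
        rw [map_zero]
        apply (N.E.metric y).definite
        -- A vanishing sum of nonnegative real parts has vanishing terms; the imaginary parts vanish
        -- by hermitian symmetry.
        have hre : ∀ k, 0 ≤ RCLike.re ((N.E.metric y).inner ((D.incl k).map y v)
          ((D.incl k).map y v)) := fun k => (N.E.metric y).re_inner_nonneg _
        have h0 := congrArg (RCLike.re : ℂ → ℝ) hv
        rw [map_sum, map_zero, Finset.sum_eq_zero_iff_of_nonneg fun k _ => hre k] at h0
        refine RCLike.ext ?_ ?_
        · rw [h0 k (Finset.mem_univ k), map_zero]
        · have := (N.E.metric y).conj_inner_symm ((D.incl k).map y v) ((D.incl k).map y v)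
          rw [map_zero, ← RCLike.conj_eq_iff_im]
          exact this }
  metric_smooth s t y hs ht := p.smoothY.sum Finset.univ fun k _ =>
    N.E.metric_smooth _ _ y ((D.incl k).smooth s y hs) ((D.incl k).smooth t y ht)

/-- The gerbe action as a linear map. -/
def actMap (z : p.Fib2) : G.L.Fiber z ⊗[ℂ] D.F.Fiber (p.pr1 z) →ₗ[ℂ] D.F.Fiber (p.pr2 z) :=
  ∑ k, (D.proj k).map _ ∘ₗ (N.ρ.map z).toLinearMap ∘ₗ ((D.incl k).map _).lTensor (G.L.Fiber z)

/-- The inverse of the gerbe action. -/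
def actInv (z : p.Fib2) : D.F.Fiber (p.pr2 z) →ₗ[ℂ] G.L.Fiber z ⊗[ℂ] D.F.Fiber (p.pr1 z) :=
  ∑ k, ((D.proj k).map _).lTensor (G.L.Fiber z) ∘ₗ (N.ρ.map z).symm.toLinearMap ∘ₗ (D.incl k).map _

lemma actMap_apply (z : p.Fib2) (t : G.L.Fiber z ⊗[ℂ] D.F.Fiber (p.pr1 z)) :
    D.actMap z t = ∑ k, (D.proj k).map _ (N.ρ.map z (((D.incl k).map _).lTensor _ t)) := by
  simp [actMap]

lemma actInv_apply (z : p.Fib2) (w : D.F.Fiber (p.pr2 z)) :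
    D.actInv z w = ∑ k, ((D.proj k).map _).lTensor _ ((N.ρ.map z).symm ((D.incl k).map _ w)) := by
  simp [actInv]

lemma sum_lTensor (z : p.Fib2) (t : G.L.Fiber z ⊗[ℂ] D.F.Fiber (p.pr1 z)) :
    ∑ k, ((D.proj k).map _).lTensor _ (((D.incl k).map _).lTensor _ t) = t := by
  induction t using TensorProduct.induction_on with
  | zero => simp
  | tmul a v => simp only [LinearMap.lTensor_tmul, ← tmul_sum, D.sum_proj_incl]
  | add x y hx hy => simp only [map_add, Finset.sum_add_distrib, hx, hy]

lemma incl_proj_act' (k l : κ) (z : p.Fib2) (t : G.L.Fiber z ⊗[ℂ] N.bundle.Fiber (p.pr1 z)) :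
    (D.incl k).map _ ((D.proj l).map _ (N.ρ.map z t)) =
      N.ρ.map z (((D.incl k).map _).lTensor _ (((D.proj l).map _).lTensor _ t)) := by
  induction t using TensorProduct.induction_on with
  | zero => simp
  | tmul a v => exact D.incl_proj_act k l z a v
  | add x y hx hy => simp only [map_add, hx, hy]

/-- Each `incl k ∘ proj l` commutes with the action of `N`; once `ρ` is pulled to the outside, the
sum over `l` of `proj l ∘ incl l` collapses to the identity. With `ext_incl`, this reduces the
module axioms for the summand to those of `N`. -/
lemma incl_actMap (k : κ) (z : p.Fib2) (t : G.L.Fiber z ⊗[ℂ] D.F.Fiber (p.pr1 z)) :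
    (D.incl k).map _ (D.actMap z t) = N.ρ.map z (((D.incl k).map _).lTensor _ t) := by
  rw [actMap_apply, map_sum]
  refine (Finset.sum_congr rfl fun l _ => D.incl_proj_act' k l z _).trans ?_
  rw [← map_sum, ← map_sum, D.sum_lTensor]

lemma actMap_actInv (z : p.Fib2) (w : D.F.Fiber (p.pr2 z)) : D.actMap z (D.actInv z w) = w := by
  refine D.ext_incl fun k => ?_
  rw [incl_actMap, actInv_apply, map_sum, map_sum]
  -- Moving `ρ` back inside places it next to its inverse.
  refine (Finset.sum_congr rfl fun l _ => (D.incl_proj_act' k l z _).symm).trans ?_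
  refine (Finset.sum_congr rfl fun l _ => congrArg _ (congrArg _
    ((N.ρ.map z).apply_symm_apply _))).trans ?_
  rw [← map_sum, D.sum_proj_incl]

lemma actInv_actMap (z : p.Fib2) (t : G.L.Fiber z ⊗[ℂ] D.F.Fiber (p.pr1 z)) :
    D.actInv z (D.actMap z t) = t := by
  rw [actInv_apply]
  simp only [incl_actMap, LinearEquiv.symm_apply_apply]
  exact D.sum_lTensor z t

lemma actMap_smooth {z : p.Fib2} {t : ∀ z, G.L.Fiber z ⊗[ℂ] D.F.Fiber (p.pr1 z)}
    (ht : (tensor G.L.toSmoothBundle (pullback p.pr1_smooth D.F)).SmoothAt t z) :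
    (pullback p.pr2_smooth D.F).SmoothAt (fun z' => D.actMap z' (t z')) z := by
  refine (pullback p.pr2_smooth D.F).smoothAt_congr
    ((pullback p.pr2_smooth D.F).smoothAt_sum Finset.univ fun k _ =>
      (D.proj k).smoothAt_pullback p.pr2_smooth (N.ρ.smooth _ z (smoothAt_lTensor G.L.toSmoothBundle
        (pullback p.pr1_smooth D.F) (pullback p.pr1_smooth N.bundle)
        (fun z => (D.incl k).map (p.pr1 z))
        (fun s hs => (D.incl k).smoothAt_pullback p.pr1_smooth hs) ht)))
    (Eventually.of_forall fun z' => (D.actMap_apply z' (t z')).symm)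

lemma actInv_smooth {z : p.Fib2} {w : ∀ z, D.F.Fiber (p.pr2 z)}
    (hw : (pullback p.pr2_smooth D.F).SmoothAt w z) :
    (tensor G.L.toSmoothBundle (pullback p.pr1_smooth D.F)).SmoothAt
      (fun z' => D.actInv z' (w z')) z := by
  refine (tensor G.L.toSmoothBundle (pullback p.pr1_smooth D.F)).smoothAt_congr
    ((tensor G.L.toSmoothBundle (pullback p.pr1_smooth D.F)).smoothAt_sum Finset.univ fun k _ =>
      smoothAt_lTensor G.L.toSmoothBundle (pullback p.pr1_smooth N.bundle)
        (pullback p.pr1_smooth D.F) (fun z => (D.proj k).map (p.pr1 z))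
        (fun s hs => (D.proj k).smoothAt_pullback p.pr1_smooth hs)
        (N.ρ.smooth_symm _ z ((D.incl k).smoothAt_pullback p.pr2_smooth hw)))
    (Eventually.of_forall fun z' => (D.actInv_apply z' (w z')).symm)

/-- The gerbe module on a vector bundle summand. -/
def gerbeModule : GerbeModule G where
  E := D.hermitian
  ρ :=
    { map := fun z => LinearEquiv.ofLinearMap (D.actMap z) (D.actInv z)
        (LinearMap.ext (D.actMap_actInv z)) (LinearMap.ext (D.actInv_actMap z))
      smooth := fun _ _ h => D.actMap_smooth h
      smooth_symm := fun _ _ h => D.actInv_smooth h }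
  unitary h a a' v v' := by
    show ∑ k, (N.E.metric _).inner ((D.incl k).map _ (D.actMap (mk2 h) (a ⊗ₜ v)))
      ((D.incl k).map _ (D.actMap (mk2 h) (a' ⊗ₜ v'))) = _ *
        ∑ k, (N.E.metric _).inner ((D.incl k).map _ v) ((D.incl k).map _ v')
    rw [Finset.mul_sum]
    -- The metric is a sum over `k` of pulled back metrics, and each summand scales by the metric of
    -- `L` because `incl k` intertwines the actions and `N` is unitary.
    refine Finset.sum_congr rfl fun k _ => ?_
    rw [incl_actMap, incl_actMap]
    exact N.unitary h a a' _ _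
  compat h h' a b v := by
    refine D.ext_incl fun k => ?_
    show (D.incl k).map _ (D.actMap (mk2 h) (a ⊗ₜ D.actMap (mk2 h') (b ⊗ₜ v))) =
      (D.incl k).map _ (D.actMap (mk2 (h.trans h')) (G.μ.map (mk3 h h') (a ⊗ₜ[ℂ] b) ⊗ₜ v))
    refine ((D.incl_actMap k (mk2 h) _).trans ?_).trans (D.incl_actMap k (mk2 (h.trans h')) _).symm
    exact (congrArg (fun x => N.ρ.map (mk2 h) (a ⊗ₜ x))
      (D.incl_actMap k (mk2 h') (b ⊗ₜ v))).trans (N.compat h h' a b _)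

/-- The inclusions, as morphisms of gerbe modules. -/
def inclHom (k : κ) : D.gerbeModule ⟶ N :=
  ⟨(D.incl k).map, (D.incl k).smooth, fun h a v => D.incl_actMap k (mk2 h) (a ⊗ₜ v)⟩

/-- The projections, as morphisms of gerbe modules. -/
def projHom (k : κ) : N ⟶ D.gerbeModule :=
  ⟨(D.proj k).map, (D.proj k).smooth, fun h a v => D.ext_incl fun l =>
    (D.incl_proj_act l k (mk2 h) a v).trans
      (D.incl_actMap l (mk2 h) (a ⊗ₜ (D.proj k).map _ v)).symm⟩

lemma sum_inclHom_projHom : ∑ k, D.inclHom k ≫ D.projHom k = 𝟙 D.gerbeModule := by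
  refine Subtype.ext (funext fun y => LinearMap.ext fun w => ?_)
  have h : (∑ k, D.inclHom k ≫ D.projHom k).1 =
      ∑ k, (D.inclHom k ≫ D.projHom k).1 :=
    map_sum (GerbeModule.homs D.gerbeModule D.gerbeModule).subtype _ _
  rw [h, Finset.sum_apply, LinearMap.sum_apply]
  exact D.sum_proj_incl y w

end BundleSummand

/-! ### Finite powers of a gerbe module. -/

namespace GerbeModule

/-- Powers of a gerbe module exist. -/
lemma exists_isPower (K : GerbeModule G) (κ : Type) [Fintype κ] [DecidableEq κ] :
    ∃ B, K.IsPower B κ := by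
  have hsmooth : ∀ (k l : κ) (s : ∀ y, K.bundle.Fiber y) (y : Y), K.bundle.SmoothAt s y →
      K.bundle.SmoothAt (fun y' => Pi.single (M := fun _ => K.bundle.Fiber y') k (s y') l) y := by
    intro k l s y hs
    by_cases h : l = k
    · subst h
      simpa only [Pi.single_eq_same] using hs
    · simpa only [Pi.single_eq_of_ne h] using K.bundle.smoothAt_zero y
  let D : BundleSummand K κ :=
    { F := power K.bundle κ
      incl := fun k => { map := fun y => LinearMap.proj k, smooth := fun s y hs => hs k }
      proj := fun k =>
        { map := fun y => LinearMap.single ℂ (fun _ => K.bundle.Fiber y) k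
          smooth := fun s y hs l => hsmooth k l s y hs }
      sum_proj_incl := fun y w => Finset.univ_sum_single w
      incl_proj_act := fun k l z a v => by
        -- The composite of a coordinate inclusion and a coordinate projection is the identity or
        -- zero, and both commute with the action.
        simp only [LinearMap.proj_apply, LinearMap.single_apply]
        by_cases h : k = l
        · subst h
          simp only [Pi.single_eq_same]
        · simp only [Pi.single_eq_of_ne h]
          rw [tmul_zero, map_zero] }
  -- The roles are reversed here: `projHom` maps `K` into the power, as the coordinate inclusions,
  -- and `inclHom` gives the coordinate projections.
  refine ⟨D.gerbeModule, D.projHom, D.inclHom, fun k l => ?_, D.sum_inclHom_projHom⟩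
  refine Subtype.ext (funext fun y => LinearMap.ext fun w => ?_)
  by_cases h : k = l
  · subst h
    rw [if_pos rfl]
    exact Pi.single_eq_same (M := fun _ => K.bundle.Fiber y) k w
  · rw [if_neg h]
    exact Pi.single_eq_of_ne (M := fun _ => K.bundle.Fiber y) (Ne.symm h) w

end GerbeModule

end

end GerbeMod

namespace GerbeMod

open SmoothBundle SurjectiveSubmersion

/-! ### Inverses, determinants and inverse matrices of smooth functions. -/

namespace SmoothFunctions

variable {X : Type u} [TopologicalSpace X] (S : SmoothFunctions X)

/-- The smooth functions without zeros are invertible. -/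
def InvClosed : Prop :=
  ∀ {f : X → ℂ} {x : X}, S.SmoothAt f x → f x ≠ 0 →
    (∀ᶠ x' in 𝓝 x, f x' ≠ 0) ∧ S.SmoothAt (fun x' => (f x')⁻¹) x

/-- Inversion is not part of `SmoothFunctions`. On a manifold, smooth functions are continuous, so
nonvanishing persists nearby, and inversion is smooth away from zero. -/
lemma ofManifold_invClosed {E H : Type*} [NormedAddCommGroup E] [NormedSpace ℝ E]
    [TopologicalSpace H] (I : ModelWithCorners ℝ E H) [ChartedSpace H X] :
    (ofManifold I X).InvClosed := by
  intro f x hf hx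
  have h0 : ∀ᶠ x' in 𝓝 x, f x' ≠ 0 :=
    hf.self_of_nhds.continuousAt.eventually_ne hx
  refine ⟨h0, ?_⟩
  filter_upwards [h0, hf] with x' hx' hf'
  exact ((contDiffAt_inv ℝ hx').contMDiffAt (x := f x')).comp x' hf'

lemma prod {κ : Type*} (s : Finset κ) {f : κ → X → ℂ} {x : X} (h : ∀ k ∈ s, S.SmoothAt (f k) x) :
    S.SmoothAt (fun x' => ∏ k ∈ s, f k x') x := by
  classical
  induction s using Finset.induction_on with
  | empty => simpa using S.const 1 x
  | insert a s ha ih =>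
    simp only [Finset.prod_insert ha]
    exact S.mul (h a (by simp)) (ih fun k hk => h k (by simp [hk]))

lemma sub {f g : X → ℂ} {x : X} (hf : S.SmoothAt f x) (hg : S.SmoothAt g x) :
    S.SmoothAt (fun x' => f x' - g x') x := by
  simpa [sub_eq_add_neg] using S.add hf (S.mul (S.const (-1) x) hg)

variable {ι κ : Type*} [Fintype ι]

lemma mulVec {A : X → Matrix κ ι ℂ} {w : X → ι → ℂ} {x : X}
    (hA : ∀ i j, S.SmoothAt (fun x' => A x' i j) x) (hw : ∀ j, S.SmoothAt (fun x' => w x' j) x)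
    (i : κ) : S.SmoothAt (fun x' => (A x').mulVec (w x') i) x :=
  S.sum Finset.univ fun j _ => S.mul (hA i j) (hw j)

lemma linearMap [DecidableEq ι] (T : (ι → ℂ) →ₗ[ℂ] (κ → ℂ)) {w : X → ι → ℂ} {x : X}
    (hw : ∀ j, S.SmoothAt (fun x' => w x' j) x) (i : κ) :
    S.SmoothAt (fun x' => T (w x') i) x := by
  have := S.mulVec (A := fun _ => LinearMap.toMatrix' T) (fun i j => S.const _ x) hw i
  simpa only [LinearMap.toMatrix'_mulVec] using this

lemma matrix_mul {A : X → Matrix κ ι ℂ} {B : X → Matrix ι κ ℂ} {x : X}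
    (hA : ∀ i j, S.SmoothAt (fun x' => A x' i j) x) (hB : ∀ i j, S.SmoothAt (fun x' => B x' i j) x)
    (i j : κ) : S.SmoothAt (fun x' => (A x' * B x') i j) x := by
  simp only [Matrix.mul_apply]
  exact S.sum Finset.univ fun k _ => S.mul (hA i k) (hB k j)

variable [DecidableEq ι]

lemma det {A : X → Matrix ι ι ℂ} {x : X} (hA : ∀ i j, S.SmoothAt (fun x' => A x' i j) x) :
    S.SmoothAt (fun x' => (A x').det) x := by
  simp only [Matrix.det_apply']
  exact S.sum Finset.univ fun σ _ => S.mul (S.const _ x) (S.prod Finset.univ fun i _ => hA _ _)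

/-- Cramer's rule: the adjugate entries are determinants of the matrix with one row replaced by a
constant unit vector. -/
lemma matrix_inv (hS : S.InvClosed) {A : X → Matrix ι ι ℂ} {x : X}
    (hA : ∀ i j, S.SmoothAt (fun x' => A x' i j) x) (hx : (A x).det ≠ 0) (i j : ι) :
    S.SmoothAt (fun x' => (A x')⁻¹ i j) x := by
  simp only [Matrix.inv_def, Ring.inverse_eq_inv', Matrix.smul_apply, smul_eq_mul,
    Matrix.adjugate_apply]
  refine S.mul (hS (S.det hA) hx).2 (S.det fun k l => ?_)
  by_cases h : k = j
  · subst h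
    simpa only [Matrix.updateRow_self] using S.const _ x
  · simpa only [Matrix.updateRow_ne h] using hA k l

end SmoothFunctions

/-! ### The image of an idempotent bundle endomorphism. -/

namespace SmoothBundle

variable {X : Type u} [TopologicalSpace X] {S : SmoothFunctions X}

/-- In a frame, `f` is a smooth idempotent matrix `P`. Where the intertwiner `g` of `P` with its
value `P₀` at `x₀` is invertible, it carries the image of `P` onto the fixed space `R`, the image of
`P₀`, and a basis of `R` gives the trivialization. -/
lemma exists_isTrivialization_range (hS : S.InvClosed) (E : SmoothBundle S) (f : Hom E E)
    (hf : ∀ x v, f.map x (f.map x v) = f.map x v) (x₀ : X) :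
    ∃ (U : Set X) (ι : Type) (_ : Finite ι) (τ : ∀ x, LinearMap.range (f.map x) →ₗ[ℂ] (ι → ℂ)),
      x₀ ∈ U ∧ IsTrivialization S
        (fun (s : ∀ x, LinearMap.range (f.map x)) x => E.SmoothAt (fun x' => (s x').1) x) U τ := by
  classical
  obtain ⟨U, ι, hι, τ, hx₀, hτ⟩ := E.locallyTrivial x₀
  have := Fintype.ofFinite ι
  obtain ⟨e, he, hev, hec⟩ := hτ.exists_frame
  have hfix : ∀ x (v : LinearMap.range (f.map x)), f.map x v.1 = v.1 := by
    rintro x ⟨_, w, rfl⟩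
    exact hf x w
  let P : X → Matrix ι ι ℂ := fun x i j => τ x (f.map x (e j x)) i
  have hPs : ∀ x ∈ U, ∀ i j, S.SmoothAt (fun x' => P x' i j) x := fun x hx i j =>
    (hτ.smoothAt_iff _ x hx).1 (f.smooth _ x (he j x hx)) i
  have hP : ∀ x ∈ U, ∀ v, (P x).mulVec (τ x v) = τ x (f.map x v) := fun x hx v => by
    conv_rhs => rw [hev x hx v, map_sum, map_sum]
    ext i
    simp only [map_smul, Finset.sum_apply, Pi.smul_apply, smul_eq_mul]
    exact Finset.sum_congr rfl fun j _ => mul_comm _ _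
  have hPP : ∀ x ∈ U, P x * P x = P x := fun x hx => by
    refine Matrix.mulVec_injective (funext fun w => ?_)
    obtain ⟨v, rfl⟩ := (hτ.bijective x hx).2 w
    rw [← Matrix.mulVec_mulVec, hP x hx, hP x hx, hf]
  let P₀ := P x₀
  have hP₀ : P₀ * P₀ = P₀ := hPP x₀ hx₀
  -- Both `g * P` and `P₀ * g` equal `P₀ * P`, and `g` is the identity at `x₀`, hence invertible
  -- nearby.
  let g : X → Matrix ι ι ℂ := fun x => P₀ * P x + (1 - P₀) * (1 - P x)
  have hgs : ∀ x ∈ U, ∀ i j, S.SmoothAt (fun x' => g x' i j) x := fun x hx i j => by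
    have h1 : ∀ k l, S.SmoothAt (fun x' => (1 - P x') k l) x := fun k l => by
      simp only [Matrix.sub_apply]
      exact S.sub (S.const _ x) (hPs x hx k l)
    have h2 := S.matrix_mul (A := fun _ => P₀) (fun k l => S.const (P₀ k l) x) (hPs x hx) i j
    have h3 := S.matrix_mul (A := fun _ => 1 - P₀) (fun k l => S.const ((1 - P₀) k l) x) h1 i j
    simp only [g, Matrix.add_apply]
    exact S.add h2 h3
  have hgP : ∀ x ∈ U, g x * P x = P₀ * P x := fun x hx => by
    simp only [g, add_mul, mul_assoc, sub_mul, hPP x hx, one_mul, sub_self, mul_zero, add_zero]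
  have hPg : ∀ x ∈ U, P₀ * g x = P₀ * P x := fun x hx => by
    simp only [g, mul_add, ← mul_assoc, mul_sub, hP₀, mul_one, sub_self, zero_mul, add_zero]
  have hg₀ : g x₀ = 1 := by
    show P₀ * P₀ + (1 - P₀) * (1 - P₀) = 1
    simp only [mul_sub, sub_mul, hP₀, one_mul, mul_one, sub_self, sub_zero]
    abel
  have hfixP : ∀ x ∈ U, ∀ v : LinearMap.range (f.map x),
      (g x).mulVec (τ x v.1) = P₀.mulVec (τ x v.1) := fun x hx v => by
    have : τ x v.1 = (P x).mulVec (τ x v.1) := by rw [hP x hx, hfix]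
    rw [this, Matrix.mulVec_mulVec, hgP x hx, Matrix.mulVec_mulVec]
  let R := LinearMap.range P₀.mulVecLin
  have hR : ∀ w : R, P₀.mulVec w.1 = w.1 := by
    rintro ⟨_, w, rfl⟩
    simp [Matrix.mulVec_mulVec, hP₀]
  let b : R ≃ₗ[ℂ] (Fin (Module.finrank ℂ R) → ℂ) := (Module.finBasis ℂ R).equivFun
  let T : (ι → ℂ) →ₗ[ℂ] (Fin (Module.finrank ℂ R) → ℂ) :=
    b.toLinearMap ∘ₗ P₀.mulVecLin.rangeRestrict
  have hbT : ∀ w, (b.symm (T w)).1 = P₀.mulVec w := fun w => by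
    simp only [T, LinearMap.comp_apply, LinearEquiv.coe_coe, LinearEquiv.symm_apply_apply]
    rfl
  -- On the image of `f`, `P₀` acts as the invertible `g`, so the components are recovered smoothly
  -- from their projections to `R`. This gives both injectivity and the converse smoothness
  -- statement.
  have hrec : ∀ x ∈ U, (g x).det ≠ 0 → ∀ v : LinearMap.range (f.map x),
      τ x v.1 = (g x)⁻¹.mulVec (b.symm (T (τ x v.1))).1 := fun x hx hd v => by
    rw [hbT, ← hfixP x hx, Matrix.mulVec_mulVec, Matrix.nonsing_inv_mul _ hd.isUnit,
      Matrix.one_mulVec]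
  refine ⟨U ∩ {x | (g x).det ≠ 0}, Fin (Module.finrank ℂ R), inferInstance,
    fun x => T ∘ₗ τ x ∘ₗ (LinearMap.range (f.map x)).subtype, ⟨hx₀, ?_⟩, ?_, ?_, ?_⟩
  · simp [hg₀]
  · rw [isOpen_iff_mem_nhds]
    rintro x ⟨hx, hd⟩
    filter_upwards [hτ.isOpen.mem_nhds hx, (hS (S.det (hgs x hx)) hd).1] with x' h h'
    exact ⟨h, h'⟩
  · rintro x ⟨hx, hd⟩
    constructor
    · intro v w hvw
      refine Subtype.ext ((hτ.bijective x hx).1 ?_)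
      rw [hrec x hx hd v, hrec x hx hd w]
      exact congrArg (fun c => (g x)⁻¹.mulVec (b.symm c).1) hvw
    · intro c
      obtain ⟨v, hv⟩ := (hτ.bijective x hx).2 ((g x)⁻¹.mulVec (b.symm c).1)
      have hgv : (g x).mulVec (τ x v) = (b.symm c).1 := by
        rw [hv, Matrix.mulVec_mulVec, Matrix.mul_nonsing_inv _ hd.isUnit, Matrix.one_mulVec]
      have hginj : Function.Injective (g x).mulVec :=
        Matrix.mulVec_injective_of_isUnit ((Matrix.isUnit_iff_isUnit_det _).2 hd.isUnit)
      -- After applying `g`: `g P τ(v) = P₀ g τ(v) = g τ(v)`, since `g τ(v)` was chosen in `R`.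
      have hfv : f.map x v = v := by
        apply (hτ.bijective x hx).1
        rw [← hP x hx]
        apply hginj
        rw [Matrix.mulVec_mulVec, hgP x hx, ← hPg x hx, ← Matrix.mulVec_mulVec, hgv, hR]
      refine ⟨⟨v, v, hfv⟩, ?_⟩
      apply b.symm.injective
      apply Subtype.ext
      rw [← hgv]
      exact (hbT _).trans (hfixP x hx ⟨v, v, hfv⟩).symm
  · rintro s x ⟨hx, hd⟩
    rw [hτ.smoothAt_iff _ x hx]
    refine ⟨fun h i => S.linearMap T h i, fun h i => ?_⟩
    refine S.congr (S.mulVec (S.matrix_inv hS (hgs x hx) hd)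
      (S.linearMap (R.subtype ∘ₗ b.symm.toLinearMap) h) i) ?_
    filter_upwards [hτ.isOpen.mem_nhds hx, (hS (S.det (hgs x hx)) hd).1] with x' h1 h2
    exact (congrFun (hrec x' h1 h2 (s x')) i).symm

/-- The image of an idempotent endomorphism of a vector bundle. -/
@[reducible]
def rangeBundle (hS : S.InvClosed) (E : SmoothBundle S) (f : Hom E E)
    (hf : ∀ x v, f.map x (f.map x v) = f.map x v) : SmoothBundle S where
  Fiber x := LinearMap.range (f.map x)
  SmoothAt s x := E.SmoothAt (fun x' => (s x').1) x
  locallyTrivial := exists_isTrivialization_range hS E f hf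

end SmoothBundle

/-! ### Splitting of idempotents of gerbe modules. -/

section

variable {EY EM : Type*} [NormedAddCommGroup EY] [NormedSpace ℝ EY] [NormedAddCommGroup EM]
  [NormedSpace ℝ EM] {Y M : Type u} [TopologicalSpace Y] [ChartedSpace EY Y]
  [TopologicalSpace M] [ChartedSpace EM M] {p : SurjectiveSubmersion EY EM Y M}
  {G : BundleGerbe p}

/-- Idempotents split in the category of gerbe modules. -/
instance : IsIdempotentComplete (GerbeModule G) where
  idempotents_split N f hff := by
    have hidem : ∀ y v, GerbeModule.fiberMap f y (GerbeModule.fiberMap f y v) =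
        GerbeModule.fiberMap f y v := fun y v =>
      LinearMap.congr_fun (congrFun (congrArg Subtype.val hff) y) v
    have hfix : ∀ y (w : LinearMap.range (GerbeModule.fiberMap f y)),
        GerbeModule.fiberMap f y w.1 = w.1 := by
      rintro y ⟨_, w, rfl⟩
      exact hidem y w
    -- A single copy of `N` suffices: inclusion after projection is `f` itself, which commutes with
    -- the action because it is a morphism.
    let D : BundleSummand N Unit :=
      { F := rangeBundle (SmoothFunctions.ofManifold_invClosed _) N.bundle ⟨f.1, f.2.1⟩ hidem
        incl := fun _ =>
          { map := fun y => (LinearMap.range (GerbeModule.fiberMap f y)).subtype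
            smooth := fun _ _ hs => hs }
        proj := fun _ =>
          { map := fun y => (GerbeModule.fiberMap f y).rangeRestrict
            smooth := fun s y hs => f.2.1 s y hs }
        sum_proj_incl := fun y w => by
          simp only [Finset.univ_unique, Finset.sum_singleton]
          exact Subtype.ext (hfix y w)
        incl_proj_act := fun _ _ z a v => f.2.2 z.2 a v }
    refine ⟨D.gerbeModule, D.inclHom (), D.projHom (), ?_, ?_⟩
    · simpa using D.sum_inclHom_projHom
    · rfl

end

end GerbeMod

namespace GerbeMod

open SmoothBundle SurjectiveSubmersion

section

variable {EY EM : Type*} [NormedAddCommGroup EY] [NormedSpace ℝ EY] [NormedAddCommGroup EM]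
  [NormedSpace ℝ EM] {Y M : Type u} [TopologicalSpace Y] [ChartedSpace EY Y]
  [TopologicalSpace M] [ChartedSpace EM M] {p : SurjectiveSubmersion EY EM Y M}
  {G : BundleGerbe p}

lemma SmoothBundle.eventually_finrank_eq {X : Type u} [TopologicalSpace X] {S : SmoothFunctions X}
    (E : SmoothBundle S) (x : X) :
    ∀ᶠ x' in 𝓝 x, Module.finrank ℂ (E.Fiber x') = Module.finrank ℂ (E.Fiber x) := by
  obtain ⟨U, ι, _, τ, hx, hτ⟩ := E.locallyTrivial x
  have h : ∀ x' ∈ U, Module.finrank ℂ (E.Fiber x') = Module.finrank ℂ (ι → ℂ) := fun x' hx' =>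
    (LinearEquiv.ofBijective _ (hτ.bijective x' hx')).finrank_eq
  filter_upwards [hτ.isOpen.mem_nhds hx] with x' hx'
  rw [h x' hx', h x hx]

namespace GerbeModule

/-! ### The rank of a gerbe module -/

/-- Tensoring with a line preserves dimension, so `ρ` forces equal ranks along the fibres of `π` and
the rank descends to `M`. -/
lemma finrank_eq_of_π_eq (N : GerbeModule G) {y₁ y₂ : Y} (h : p.π y₁ = p.π y₂) :
    Module.finrank ℂ (N.bundle.Fiber y₁) = Module.finrank ℂ (N.bundle.Fiber y₂) := by
  have h1 := (N.act h).finrank_eq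
  rw [Module.finrank_tensorProduct, G.finrank_eq_one, one_mul] at h1
  exact h1.symm

lemma IsNontrivial.nontrivial_fiber {K : GerbeModule G} (hK : K.IsNontrivial) (y : Y) :
    Nontrivial (K.bundle.Fiber y) := by
  let r : M → ℕ := fun m => Module.finrank ℂ (K.bundle.Fiber (p.surjective m).choose)
  have hr : ∀ y, r (p.π y) = Module.finrank ℂ (K.bundle.Fiber y) := fun y =>
    K.finrank_eq_of_π_eq (p.surjective (p.π y)).choose_spec
  -- Local sections of the submersion transfer local constancy of the rank from `Y` to `M`; the rank
  -- is then constant on connected components.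
  have hloc : IsLocallyConstant r := by
    rw [IsLocallyConstant.iff_eventually_eq]
    intro m
    obtain ⟨y, rfl⟩ := p.surjective m
    obtain ⟨W, σ, hW, hyW, hσy, hσ, hσs⟩ := p.exists_section y
    have hc : ContinuousAt σ (p.π y) := hσs.continuousOn.continuousAt (hW.mem_nhds hyW)
    have h1 := K.bundle.eventually_finrank_eq y
    rw [← hσy] at h1
    filter_upwards [hc.eventually h1, hW.mem_nhds hyW] with m' h2 h3
    rw [hr y, ← hσy, ← h2, ← hr, hσ m' h3]
  obtain ⟨y', hy', hnt⟩ := hK (p.π y)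
  have := K.bundle.finiteDimensional y
  have := K.bundle.finiteDimensional y'
  apply Module.nontrivial_of_finrank_pos (R := ℂ)
  rw [← hr, hloc.apply_eq_of_isPreconnected isPreconnected_connectedComponent
    mem_connectedComponent hy', hr]
  exact Module.finrank_pos

/-! ### The fibres of the endomorphism bundle -/

/-- The value at `y` of an element of the fibre of the descended endomorphism bundle. -/
def evalAlgHom (K : GerbeModule G) {m : M} (y : {y : Y // p.π y = m}) :
    K.endBundle.Fiber m →ₐ[ℂ] Module.End ℂ (K.bundle.Fiber y.1) where
  toFun s := s.1 y
  map_one' := rfl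
  map_mul' _ _ := rfl
  map_zero' := rfl
  map_add' _ _ := rfl
  commutes' _ := rfl

/-- A compatible family is determined by its value at one point over `m`, and any value there
extends to the other points by transport. -/
lemma evalAlgHom_bijective (K : GerbeModule G) {m : M} (y : {y : Y // p.π y = m}) :
    Function.Bijective (K.evalAlgHom y) := by
  constructor
  · intro s t hst
    refine Subtype.ext (funext fun y' => ?_)
    rw [← s.2 y' y, ← t.2 y' y]
    exact congrArg _ hst
  · intro β
    refine ⟨⟨fun y' => (K.homDatum K).tr (y'.2.trans y.2.symm) β,
      fun _ _ => (K.homDatum K).tr_tr _ _ _⟩, ?_⟩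
    exact (K.homDatum K).tr_self _ _

lemma IsNontrivial.isAzumayaBundle {K : GerbeModule G} (hK : K.IsNontrivial) :
    K.endBundle.IsAzumayaBundle := by
  intro m
  obtain ⟨y, hy⟩ := p.surjective m
  have := K.bundle.finiteDimensional y
  have := hK.nontrivial_fiber y
  let b := Module.finBasis ℂ (K.bundle.Fiber y)
  -- This is where nontriviality enters: the matrix algebra must have positive size.
  have : Nonempty (Fin (Module.finrank ℂ (K.bundle.Fiber y))) := b.index_nonempty
  have := IsAzumaya.matrix ℂ (Fin (Module.finrank ℂ (K.bundle.Fiber y)))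
  exact IsAzumaya.of_AlgEquiv _ _ _ ((AlgEquiv.ofBijective (K.evalAlgHom ⟨y, hy⟩)
    (K.evalAlgHom_bijective ⟨y, hy⟩)).trans (algEquivMatrix b)).symm

/-! ### A nontrivial gerbe module is a generator -/

/-- The product of a morphism of gerbe modules with a smooth function on the base. -/
def functionSmul {N P : GerbeModule G} (c : M → ℂ) (hc : ∀ m, p.smoothM.SmoothAt c m)
    (f : N ⟶ P) : N ⟶ P :=
  ⟨fun y => c (p.π y) • fiberMap f y, fun s y hs => P.bundle.smoothAt_smul
    (p.π_smooth.comp c y (hc _)) (f.2.1 s y hs), fun {y₁ y₂} h a v => by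
      have := f.2.2 h a v
      simp only [LinearMap.smul_apply, tmul_smul, map_smul, h]
      exact congrArg _ this⟩

/-- Local homomorphisms, cut off by a smooth function, extend to morphisms of gerbe modules. -/
lemma exists_hom_of_local (N P : GerbeModule G) {O : Set M} {σ : M → Y} (hO : IsOpen O)
    (hσ : ∀ m ∈ O, p.π (σ m) = m) (hσs : ContMDiffOn 𝓘(ℝ, EM) 𝓘(ℝ, EY) ∞ σ O)
    {χ : M → ℂ} (hχ : ∀ m, p.smoothM.SmoothAt χ m) (hχO : tsupport χ ⊆ O)
    (b : ∀ y, N.bundle.Fiber y →ₗ[ℂ] P.bundle.Fiber y)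
    (hb : ∀ m ∈ O, (homBundle N.bundle P.bundle).SmoothAt b (σ m)) :
    ∃ f : N ⟶ P, (∀ m ∈ O, fiberMap f (σ m) = χ m • b (σ m)) ∧
      ∀ y, p.π y ∉ O → fiberMap f y = 0 := by
  classical
  let D := N.homDatum P
  -- Over `O`, the value at `σ m` is transported to the whole fibre over `m`; the cutoff allows
  -- extension by zero.
  let s : ∀ m, D.descendFiber m := fun m => if h : m ∈ O then
    χ m • ⟨fun y => D.tr (y.2.trans (hσ m h).symm) (b (σ m)), fun _ _ => D.tr_tr _ _ _⟩ else 0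
  have hsσ : ∀ m ∈ O, D.lift s (σ m) = χ m • b (σ m) := fun m h => by
    rw [← D.lift_eq s (hσ m h)]
    simp only [s, dif_pos h]
    exact congrArg (χ m • ·) (D.tr_self _ _)
  have hs0 : ∀ y, χ (p.π y) = 0 → D.lift s y = 0 := fun y h => by
    by_cases hy : p.π y ∈ O
    · simp only [DescentDatum.lift, s, dif_pos hy, h, zero_smul]
      rfl
    · simp only [DescentDatum.lift, s, dif_neg hy]
      rfl
  have hsm : ∀ m, D.descend.SmoothAt s m := by
    rintro _ y rfl
    by_cases hy : p.π y ∈ O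
    · refine D.smoothAt_lift_of_transport s hO hσ hσs hy (κ := Unit) (fun _ => χ) (fun _ => b)
        (fun _ => hχ _) (fun _ => hb _ hy) ?_
      filter_upwards [hO.mem_nhds hy] with m hm
      rw [hsσ m hm]
      simp
    · refine D.E.smoothAt_congr (D.E.smoothAt_zero y) ?_
      -- A point outside `O` is off the closed support of `χ`, so the section vanishes on a whole
      -- neighbourhood.
      have h1 : (tsupport χ)ᶜ ∈ 𝓝 (p.π y) :=
        (isClosed_tsupport χ).isOpen_compl.mem_nhds fun h => hy (hχO h)
      filter_upwards [p.contMDiff.continuous.continuousAt h1] with y' h2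
      exact (hs0 y' (image_eq_zero_of_notMem_tsupport h2)).symm
  exact ⟨homOfSection ⟨s, hsm⟩, hsσ, fun y hy =>
    hs0 y (image_eq_zero_of_notMem_tsupport fun h => hy (hχO h))⟩

/-- Multiplication by the function `c` on `N` factors through a power of `K`. -/
def Factors (K N : GerbeModule G) (c : M → ℂ) : Prop :=
  ∃ (κ : Type) (_ : Fintype κ) (γ : κ → (N ⟶ K)) (β : κ → (K ⟶ N)),
    ∀ y, ∑ k, fiberMap (β k) y ∘ₗ fiberMap (γ k) y = c (p.π y) • LinearMap.id

variable {K N : GerbeModule G}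

lemma Factors.add {c c' : M → ℂ} (h : K.Factors N c) (h' : K.Factors N c') :
    K.Factors N (fun m => c m + c' m) := by
  obtain ⟨κ, _, γ, β, h⟩ := h
  obtain ⟨κ', _, γ', β', h'⟩ := h'
  refine ⟨κ ⊕ κ', inferInstance, Sum.elim γ γ', Sum.elim β β', fun y => ?_⟩
  rw [Fintype.sum_sum_type, add_smul, ← h, ← h']
  rfl

/-- Functions on the base act centrally on morphisms, so `c` can be absorbed into the `β k`. -/
lemma Factors.mul {c c' : M → ℂ} (hc : ∀ m, p.smoothM.SmoothAt c m) (h : K.Factors N c') :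
    K.Factors N (fun m => c m * c' m) := by
  obtain ⟨κ, _, γ, β, h⟩ := h
  refine ⟨κ, inferInstance, γ, fun k => functionSmul c hc (β k), fun y => ?_⟩
  rw [mul_smul, ← h, Finset.smul_sum]
  rfl

lemma factors_zero : K.Factors N (fun _ => 0) :=
  ⟨Empty, inferInstance, Empty.elim, Empty.elim, fun y => by simp⟩

lemma Factors.generates (h : K.Factors N (fun _ => 1)) : K.Generates N := by
  obtain ⟨κ, _, γ, β, h⟩ := h
  refine ⟨κ, inferInstance, γ, β, Subtype.ext (funext fun y => ?_)⟩
  have h1 : (∑ k, γ k ≫ β k).1 = ∑ k, (γ k ≫ β k).1 := map_sum (homs N N).subtype _ _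
  rw [h1, Finset.sum_apply]
  exact (h y).trans (one_smul _ _)

/-- Near each point, a gerbe module is a summand of a power of a module without zero fibres. -/
lemma exists_factors_near (K N : GerbeModule G) (y₀ : Y) (hK : Nontrivial (K.bundle.Fiber y₀)) :
    ∃ O : Set M, IsOpen O ∧ p.π y₀ ∈ O ∧ ∀ χ : M → ℂ, (∀ m, p.smoothM.SmoothAt χ m) →
      tsupport χ ⊆ O → K.Factors N (fun m => χ m * χ m) := by
  classical
  obtain ⟨W, σ, hW, hyW, hσy, hσ, hσs⟩ := p.exists_section y₀
  obtain ⟨U, ι, hι, τ, hx, hτ⟩ := K.bundle.locallyTrivial y₀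
  obtain ⟨U', ι', hι', τ', hx', hτ'⟩ := N.bundle.locallyTrivial y₀
  have := Fintype.ofFinite ι
  have := Fintype.ofFinite ι'
  obtain ⟨e, he, hev, hec⟩ := hτ.exists_frame
  obtain ⟨e', he', hev', hec'⟩ := hτ'.exists_frame
  -- A single frame vector `e i` of `K` is enough, and one exists because the fibre is nonzero.
  obtain ⟨i⟩ : Nonempty ι := by
    by_contra hne
    rw [not_nonempty_iff] at hne
    obtain ⟨v, hv⟩ := exists_ne (0 : K.bundle.Fiber y₀)
    exact hv ((hev y₀ hx v).trans (by simp))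
  have hei : ∀ y ∈ U, τ y (e i y) i = 1 := fun y hy => by
    have := congrFun (hec y hy (Pi.single i 1)) i
    simpa [Pi.single_apply, ite_smul] using this
  refine ⟨W ∩ σ ⁻¹' (U ∩ U'), hσs.continuousOn.isOpen_inter_preimage hW
    (hτ.isOpen.inter hτ'.isOpen), ⟨hyW, by rw [mem_preimage, hσy]; exact ⟨hx, hx'⟩⟩,
    fun χ hχ hχO => ?_⟩
  have hO := hσs.continuousOn.isOpen_inter_preimage hW (hτ.isOpen.inter hτ'.isOpen)
  -- At `σ m`, up to the cutoff, `β j` sends `e i` to `e' j` and `γ j` takes the `j`-th component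
  -- times `e i`. Their composites are the coordinate projections of `N`, whose sum is the identity.
  -- Both are cut off, hence the square of `χ`.
  choose β hβ hβ0 using fun j : ι' => K.exists_hom_of_local N hO (fun m hm => hσ m hm.1)
    (hσs.mono inter_subset_left) hχ hχO
    (fun y => (LinearMap.proj i ∘ₗ τ y).smulRight (e' j y))
    (fun m hm s hs => N.bundle.smoothAt_smul ((hτ.smoothAt_iff _ _ hm.2.1).1 hs i)
      (he' j _ hm.2.2))
  choose γ hγ hγ0 using fun j : ι' => N.exists_hom_of_local K hO (fun m hm => hσ m hm.1)
    (hσs.mono inter_subset_left) hχ hχO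
    (fun y => (LinearMap.proj j ∘ₗ τ' y).smulRight (e i y))
    (fun m hm s hs => K.bundle.smoothAt_smul ((hτ'.smoothAt_iff _ _ hm.2.2).1 hs j)
      (he i _ hm.2.1))
  refine ⟨ι', inferInstance, γ, β, fun y => ?_⟩
  by_cases hy : p.π y ∈ W ∩ σ ⁻¹' (U ∩ U')
  · have h : p.π y = p.π (σ (p.π y)) := (hσ _ hy.1).symm
    -- The maps are known explicitly only along `σ`; compatibility with transport carries the
    -- identity to every other point of the fibre.
    have h1 : ∀ j, fiberMap (β j) y ∘ₗ fiberMap (γ j) y =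
        N.homTr N h (fiberMap (β j) (σ (p.π y)) ∘ₗ fiberMap (γ j) (σ (p.π y))) := fun j => by
      rw [homTr_comp N K N h, homTr_fiberMap, homTr_fiberMap]
    simp only [h1]
    rw [← map_sum]
    have h2 : ∑ j, fiberMap (β j) (σ (p.π y)) ∘ₗ fiberMap (γ j) (σ (p.π y)) =
        (χ (p.π y) * χ (p.π y)) • LinearMap.id := by
      ext v
      simp only [hβ _ _ hy, hγ _ _ hy, LinearMap.sum_apply, LinearMap.comp_apply,
        LinearMap.smul_apply, LinearMap.smulRight_apply, LinearMap.proj_apply, map_smul,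
        hei _ hy.2.1, LinearMap.id_apply, smul_smul, mul_one]
      conv_rhs => rw [hev' _ hy.2.2 v, Finset.smul_sum]
      exact Finset.sum_congr rfl fun j _ => by rw [smul_smul]; congr 1; ring
    rw [h2, map_smul, homTr_id]
  · have hχ0 : χ (p.π y) = 0 := image_eq_zero_of_notMem_tsupport fun h => hy (hχO h)
    simp [hβ0 _ _ hy, hχ0]

lemma smoothAt_ofReal {g : M → ℝ} (hg : ContMDiff 𝓘(ℝ, EM) 𝓘(ℝ) ∞ g) (m : M) :
    p.smoothM.SmoothAt (fun m => (g m : ℂ)) m :=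
  Eventually.of_forall fun m' =>
    (Complex.ofRealCLM.contDiff.contMDiff (x := g m')).comp m' hg.contMDiffAt

lemma IsNontrivial.generates [FiniteDimensional ℝ EM] [T2Space M] [CompactSpace M]
    [IsManifold 𝓘(ℝ, EM) ∞ M] (hK : K.IsNontrivial) (N : GerbeModule G) : K.Generates N := by
  -- Compactness replaces a partition of unity: sets on which some admissible `g` is positive are
  -- closed under finite unions, by adding the functions. Global nonnegativity is carried along so
  -- that sums stay positive. Locally, `g` is the square of a bump function.
  obtain ⟨g, hg, hg0, hpos, hfac⟩ := isCompact_univ.induction_on (X := M)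
    (p := fun s => ∃ g : M → ℝ, ContMDiff 𝓘(ℝ, EM) 𝓘(ℝ) ∞ g ∧ (∀ m, 0 ≤ g m) ∧
      (∀ m ∈ s, 0 < g m) ∧ K.Factors N (fun m => (g m : ℂ)))
    ⟨fun _ => 0, contMDiff_const, fun _ => le_rfl, fun _ h => h.elim, by
      simpa using factors_zero⟩
    (fun s t hst ⟨g, h1, h2, h3, h4⟩ => ⟨g, h1, h2, fun m hm => h3 m (hst hm), h4⟩)
    (fun s t ⟨g, h1, h2, h3, h4⟩ ⟨g', h1', h2', h3', h4'⟩ => ⟨fun m => g m + g' m, h1.add h1',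
      fun m => add_nonneg (h2 m) (h2' m), fun m hm => hm.elim
        (fun hm => add_pos_of_pos_of_nonneg (h3 m hm) (h2' m))
        (fun hm => add_pos_of_nonneg_of_pos (h2 m) (h3' m hm)), by
      simpa using h4.add h4'⟩)
    (fun m _ => by
      obtain ⟨y, rfl⟩ := p.surjective m
      obtain ⟨O, hO, hyO, hfac⟩ := exists_factors_near K N y (hK.nontrivial_fiber y)
      obtain ⟨χ, -, hχO⟩ := (SmoothBumpFunction.nhds_basis_tsupport (I := 𝓘(ℝ, EM))
        (p.π y)).mem_iff.1 (hO.mem_nhds hyO)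
      have hχ := χ.contMDiff
      refine ⟨{m | χ m ≠ 0}, mem_nhdsWithin_of_mem_nhds
        (hχ.continuous.continuousAt.eventually_ne (by rw [χ.eq_one]; exact one_ne_zero)),
        fun m => χ m * χ m, hχ.mul hχ, fun m => mul_self_nonneg _,
        fun m hm => mul_self_pos.2 hm, ?_⟩
      have hsupp : tsupport (fun m => (χ m : ℂ)) ⊆ tsupport χ :=
        tsupport_comp_subset Complex.ofReal_zero χ
      simpa using hfac (fun m => χ m) (smoothAt_ofReal hχ) (hsupp.trans hχO))
  have hne : ∀ m, (g m : ℂ) ≠ 0 := fun m => Complex.ofReal_ne_zero.2 (hpos m (mem_univ m)).ne'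
  refine Factors.generates ?_
  -- Dividing by the nowhere vanishing `g` normalises the factored function to `1`.
  simpa [hne] using hfac.mul (c := fun m => (g m : ℂ)⁻¹) fun m =>
    (SmoothFunctions.ofManifold_invClosed 𝓘(ℝ, EM) (smoothAt_ofReal (p := p) hg m) (hne m)).2

end GerbeModule

end

end GerbeMod

/-! ### The equivalence between gerbe modules and finitely generated projective modules. -/

theorem theorem3p2p3 {EM EY : Type*}
    [NormedAddCommGroup EM] [NormedSpace ℝ EM] [FiniteDimensional ℝ EM]
    [NormedAddCommGroup EY] [NormedSpace ℝ EY] [FiniteDimensional ℝ EY]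
    {M Y : Type u}
    [TopologicalSpace M] [T2Space M] [CompactSpace M] [ChartedSpace EM M]
    [IsManifold 𝓘(ℝ, EM) ∞ M]
    [TopologicalSpace Y] [T2Space Y] [SecondCountableTopology Y] [ChartedSpace EY Y]
    [IsManifold 𝓘(ℝ, EY) ∞ Y]
    (p : GerbeMod.SurjectiveSubmersion EY EM Y M) (G : GerbeMod.BundleGerbe p)
    (K : GerbeMod.GerbeModule G) (hK : K.IsNontrivial) :
    K.endBundle.IsAzumayaBundle ∧
    ∃ h : ∀ N : GerbeMod.GerbeModule G,
        GerbeMod.pfmod K.azumayaAlgebra (K.sectionFunctor.obj N),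
      ((GerbeMod.pfmod K.azumayaAlgebra).lift K.sectionFunctor h).Additive ∧
      ((GerbeMod.pfmod K.azumayaAlgebra).lift K.sectionFunctor h).Linear ℂ ∧
      ((GerbeMod.pfmod K.azumayaAlgebra).lift K.sectionFunctor h).Full ∧
      ((GerbeMod.pfmod K.azumayaAlgebra).lift K.sectionFunctor h).Faithful ∧
      ((GerbeMod.pfmod K.azumayaAlgebra).lift K.sectionFunctor h).EssSurj ∧
      ((GerbeMod.pfmod K.azumayaAlgebra).lift K.sectionFunctor h).IsEquivalence := by
  exact ⟨hK.isAzumayaBundle, GerbeMod.GerbeModule.sectionFunctor_properties hK.generates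
    fun n => K.exists_isPower (Fin n)⟩

end
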